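/- All Banach lattices are real. A sequence in a Banach lattice is called positive if all of its terms are $\ge 0$. A Banach lattice $E$ has the *weak Dunford-Pettis property* (w-DPP) if every weakly compact operator from $E$ into any Banach space maps weakly null sequences of pairwise disjoint vectors of $E$ to norm null sequences; it has the *positive Schur property* if every positive weakly null sequence in $E$ is norm null. For $n \ge 1$ and Banach lattices $E_1,\dots,E_n$, let $E_1\bar\otimes\cdots\bar\otimes E_n$ be their Riesz space tensor product, i.e. the Archimedean Riesz space which is universal for Riesz multimorphisms (multilinear maps that are lattice homomorphisms in each variable when the other variables are fixed at positive vectors) from $E_1\times\cdots\times E_n$ into Archimedean Riesz spaces. The Fremlin positive projective tensor product $E_1\widehat{\otimes}_{|\pi|}\cdots\widehat{\otimes}_{|\pi|}E_n$ is the completion of $E_1\bar\otimes\cdots\bar\otimes E_n$ with respect to the norm $$\|u\|_{|\pi|}=\inf\Big\{\sum_{k=1}^m \|y_k^1\|\cdots\|y_k^n\| \;:\; m\in\mathbb N,\ 0\le y_k^i\in E_i,\ |u|\le \sum_{k=1}^m y_k^1\otimes\cdots\otimes y_k^n\Big\}.$$ **Proposition.** Let $n\ge 1$ and let $E_1,\dots,E_n$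 be Banach lattices, each of which has the w-DPP and lacks the positive Schur property. Then there are positive sequences $(x^i_j)_{j=1}^\infty$ in $E_i$, $i=1,\dots,n$, such that the sequence $(x^1_j\otimes\cdots\otimes x^n_j)_{j=1}^\infty$ is weakly null but not norm null in $E_1\widehat{\otimes}_{|\pi|}\cdots\widehat{\otimes}_{|\pi|}E_n$. -/

import Mathlib

open Filter Topology

universe u

/-! ### Weak convergence and two properties of Banach lattices -/

/-- The sequence `x` converges to `0` in the weak topology of the normed space `E`. -/
def WeaklyNull {E : Type*} [SeminormedAddCommGroup E] [NormedSpace ℝ E] (x : ℕ → E) : Prop :=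
  ∀ f : StrongDual ℝ E, Tendsto (fun j => f (x j)) atTop (𝓝 0)

/-- The sequence `x` converges to `0` in norm. -/
def NormNull {E : Type*} [SeminormedAddCommGroup E] (x : ℕ → E) : Prop :=
  Tendsto (fun j => ‖x j‖) atTop (𝓝 0)

/-- A bounded operator is weakly compact if it maps the closed unit ball to a set whose closure in
the weak topology is weakly compact. -/
def IsWeaklyCompactOperator {E F : Type*} [NormedAddCommGroup E] [NormedSpace ℝ E]
    [NormedAddCommGroup F] [NormedSpace ℝ F] (T : E →L[ℝ] F) : Prop :=
  IsCompact (closure (toWeakSpace ℝ F '' (T '' Metric.closedBall (0 : E) 1)))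

/-- Weak Dunford-Pettis property: every weakly compact operator into a Banach space maps weakly
null sequences of pairwise disjoint vectors to norm null sequences. -/
def WeakDunfordPettis (E : Type u) [NormedAddCommGroup E] [NormedSpace ℝ E] [Lattice E] : Prop :=
  ∀ (F : Type u) [NormedAddCommGroup F] [NormedSpace ℝ F] [CompleteSpace F] (T : E →L[ℝ] F),
    IsWeaklyCompactOperator T → ∀ x : ℕ → E, WeaklyNull x →
      (∀ j k, j ≠ k → |x j| ⊓ |x k| = 0) → NormNull (fun j => T (x j))

/-- Positive Schur property: weakly null sequences of positive vectors are norm null. -/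
def PositiveSchur (E : Type u) [NormedAddCommGroup E] [NormedSpace ℝ E] [Lattice E] : Prop :=
  ∀ x : ℕ → E, (∀ j, 0 ≤ x j) → WeaklyNull x → NormNull x

/-! ### The Riesz space tensor product -/

/-- A vector lattice is Archimedean if `n • a ≤ b` for all `n` implies `a ≤ 0`. (Mathlib's
`Archimedean` is the different notion in which every positive element is a strong unit.) -/
def IsArchimedeanLattice (G : Type*) [AddCommGroup G] [Lattice G] : Prop :=
  ∀ a b : G, (∀ n : ℕ, n • a ≤ b) → a ≤ 0

/-- A multilinear map between vector lattices is a Riesz multimorphism if, whenever all variables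
but one are fixed at positive vectors, it is a lattice homomorphism in the remaining variable. -/
def IsRieszMultimorphism {ι : Type} {E : ι → Type*} [∀ i, AddCommGroup (E i)]
    [∀ i, Module ℝ (E i)] [∀ i, Lattice (E i)] {G : Type*} [AddCommGroup G] [Module ℝ G]
    [Lattice G] (φ : MultilinearMap ℝ E G) : Prop :=
  ∀ [DecidableEq ι] (x : ∀ i, E i) (i : ι) (y z : E i), (∀ j, j ≠ i → 0 ≤ x j) →
    φ (Function.update x i (y ⊔ z)) = φ (Function.update x i y) ⊔ φ (Function.update x i z)

/-- An Archimedean vector lattice together with a Riesz multimorphism into it. -/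
structure RieszModel {ι : Type} (E : ι → Type u) [∀ i, AddCommGroup (E i)]
    [∀ i, Module ℝ (E i)] [∀ i, Lattice (E i)] where
  carrier : Type u
  [addCommGroup : AddCommGroup carrier]
  [module : Module ℝ carrier]
  [lattice : Lattice carrier]
  [isOrderedAddMonoid : IsOrderedAddMonoid carrier]
  [isOrderedModule : IsOrderedModule ℝ carrier]
  archimedean : IsArchimedeanLattice carrier
  map : MultilinearMap ℝ E carrier
  isRieszMultimorphism : IsRieszMultimorphism map

attribute [instance] RieszModel.addCommGroup RieszModel.module RieszModel.lattice
  RieszModel.isOrderedAddMonoid RieszModel.isOrderedModule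

/-- Formal vector lattice expressions in symbols from `S`. -/
inductive RieszTerm (S : Type u) : Type u
  | of (s : S) : RieszTerm S
  | zero : RieszTerm S
  | add (s t : RieszTerm S) : RieszTerm S
  | smul (c : ℝ) (t : RieszTerm S) : RieszTerm S
  | sup (s t : RieszTerm S) : RieszTerm S

/-- The value of a formal expression in a vector lattice, given the values of the symbols. -/
def RieszTerm.eval {S : Type u} {G : Type*} [AddCommGroup G] [Module ℝ G] [Lattice G]
    (v : S → G) : RieszTerm S → G
  | of s => v s
  | zero => 0
  | add s t => s.eval v + t.eval v
  | smul c t => c • t.eval v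
  | sup s t => s.eval v ⊔ t.eval v

section RieszTensor

variable {ι : Type} (E : ι → Type u) [∀ i, AddCommGroup (E i)] [∀ i, Module ℝ (E i)]
  [∀ i, Lattice (E i)]

/-- Two expressions in elementary tensors are identified if they take the same value under every
Riesz multimorphism into an Archimedean vector lattice. -/
def rieszTensorSetoid : Setoid (RieszTerm (∀ i, E i)) where
  r s t := ∀ M : RieszModel E, s.eval M.map = t.eval M.map
  iseqv := ⟨fun _ _ => rfl, fun h M => (h M).symm, fun h k M => (h M).trans (k M)⟩

/-- The (Archimedean) Riesz space tensor product of the vector lattices `E i`, that is, the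
Archimedean vector lattice that is universal for Riesz multimorphisms on `∏ i, E i`. -/
def RieszTensor : Type u := Quotient (rieszTensorSetoid E)

namespace RieszTensor

variable {E}

/-- The element of the tensor product denoted by a formal expression. -/
def mk (t : RieszTerm (∀ i, E i)) : RieszTensor E := Quotient.mk (rieszTensorSetoid E) t

theorem mk_surjective : Function.Surjective (mk (E := E)) := Quotient.mk_surjective

/-- The linear lattice homomorphism induced by a Riesz multimorphism. -/
def lift (M : RieszModel E) (a : RieszTensor E) : M.carrier :=
  Quotient.lift (fun t : RieszTerm (∀ i, E i) => t.eval M.map) (fun s t h =>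
    (show ∀ N : RieszModel E, s.eval N.map = t.eval N.map from h) M) a

/-- All values of an element of the tensor product. -/
def values (a : RieszTensor E) : ∀ M : RieszModel E, M.carrier := fun M => lift M a

theorem values_injective : Function.Injective (values (E := E)) := by
  intro a b
  refine Quotient.inductionOn₂ a b (fun s t h => Quotient.sound (fun M => congrFun h M))

instance : Zero (RieszTensor E) := ⟨mk RieszTerm.zero⟩

instance : Add (RieszTensor E) :=
  ⟨Quotient.map₂ RieszTerm.add (fun _ _ h _ _ k M => congrArg₂ (· + ·) (h M) (k M))⟩

instance : SMul ℝ (RieszTensor E) :=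
  ⟨fun c => Quotient.map (RieszTerm.smul c) (fun _ _ h M => congrArg (c • ·) (h M))⟩

instance : Max (RieszTensor E) :=
  ⟨Quotient.map₂ RieszTerm.sup (fun _ _ h _ _ k M => congrArg₂ (· ⊔ ·) (h M) (k M))⟩

instance : Neg (RieszTensor E) := ⟨fun a => (-1 : ℝ) • a⟩
instance : Sub (RieszTensor E) := ⟨fun a b => a + -b⟩
instance : SMul ℕ (RieszTensor E) := ⟨fun n a => (n : ℝ) • a⟩
instance : SMul ℤ (RieszTensor E) := ⟨fun n a => (n : ℝ) • a⟩
instance : Min (RieszTensor E) := ⟨fun a b => -(-a ⊔ -b)⟩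
instance : LE (RieszTensor E) := ⟨fun a b => ∀ M : RieszModel E, lift M a ≤ lift M b⟩
instance : LT (RieszTensor E) := ⟨fun a b => values a < values b⟩

theorem values_zero : values (0 : RieszTensor E) = 0 := rfl

theorem values_add (a b : RieszTensor E) : values (a + b) = values a + values b :=
  Quotient.inductionOn₂ a b (fun _ _ => rfl)

theorem values_smul (c : ℝ) (a : RieszTensor E) : values (c • a) = c • values a :=
  Quotient.inductionOn a (fun _ => rfl)

theorem values_sup (a b : RieszTensor E) : values (a ⊔ b) = values a ⊔ values b :=
  Quotient.inductionOn₂ a b (fun _ _ => rfl)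

theorem values_neg (a : RieszTensor E) : values (-a) = -values a :=
  (values_smul (-1) a).trans (neg_one_smul ℝ _)

theorem values_inf (a b : RieszTensor E) : values (a ⊓ b) = values a ⊓ values b := by
  change values (-(-a ⊔ -b)) = _
  funext M
  simp only [values_neg, values_sup, Pi.neg_apply, Pi.sup_apply, Pi.inf_apply]
  rw [neg_sup, neg_neg, neg_neg]

instance : AddCommGroup (RieszTensor E) :=
  values_injective.addCommGroup values values_zero values_add values_neg
    (fun a b => by
      change values (a + -b) = _
      rw [values_add, values_neg, sub_eq_add_neg])
    (fun a n => by
      change values ((n : ℝ) • a) = _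
      rw [values_smul, Nat.cast_smul_eq_nsmul])
    (fun a n => by
      change values ((n : ℝ) • a) = _
      rw [values_smul, Int.cast_smul_eq_zsmul])

instance : Module ℝ (RieszTensor E) :=
  values_injective.module ℝ ⟨⟨values, values_zero⟩, values_add⟩ values_smul

instance : Lattice (RieszTensor E) :=
  values_injective.lattice values Iff.rfl Iff.rfl values_sup values_inf

instance : IsOrderedAddMonoid (RieszTensor E) where
  add_le_add_left a b h c M := by
    change values (a + c) M ≤ values (b + c) M
    rw [values_add, values_add]
    exact add_le_add_left (h M) _

instance : IsOrderedModule ℝ (RieszTensor E) where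
  smul_le_smul_of_nonneg_left c hc a b h M := by
    change values (c • a) M ≤ values (c • b) M
    rw [values_smul, values_smul]
    exact smul_le_smul_of_nonneg_left (h M) hc
  smul_le_smul_of_nonneg_right a ha c d h M := by
    change values (c • a) M ≤ values (d • a) M
    rw [values_smul, values_smul]
    exact smul_le_smul_of_nonneg_right h (ha M)

/-- The elementary tensor `⊗ i, x i`, as a multilinear map. -/
def tmul : MultilinearMap ℝ E (RieszTensor E) where
  toFun x := mk (RieszTerm.of x)
  map_update_add' x i y z := values_injective <|
    (funext (fun M => M.map.map_update_add x i y z)).trans (values_add _ _).symm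
  map_update_smul' x i c y := values_injective <|
    (funext (fun M => M.map.map_update_smul x i c y)).trans (values_smul _ _).symm

/-! The next facts are the universal property of the Riesz space tensor product. -/

theorem isArchimedeanLattice : IsArchimedeanLattice (RieszTensor E) := by
  intro a b h M
  refine M.archimedean _ (lift M b) (fun n => ?_)
  have h1 := h n M
  have h2 : values (n • a) = n • values a :=
    map_nsmul (⟨⟨values, values_zero⟩, values_add⟩ : RieszTensor E →+ _) n a
  exact (congrFun h2 M).symm.le.trans h1

theorem isRieszMultimorphism_tmul : IsRieszMultimorphism (tmul (E := E)) := by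
  intro _ x i y z hx
  exact values_injective <|
    (funext (fun M => M.isRieszMultimorphism x i y z hx)).trans (values_sup _ _).symm

theorem existsUnique_lift (M : RieszModel E) :
    ∃! T : RieszTensor E →ₗ[ℝ] M.carrier,
      (∀ a b, T (a ⊔ b) = T a ⊔ T b) ∧ ∀ x, T (tmul x) = M.map x := by
  refine ⟨⟨⟨lift M, fun a b => congrFun (values_add a b) M⟩,
    fun c a => congrFun (values_smul c a) M⟩,
    ⟨fun a b => congrFun (values_sup a b) M, fun _ => rfl⟩, ?_⟩
  rintro T ⟨hsup, htmul⟩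
  ext a
  obtain ⟨t, rfl⟩ := mk_surjective a
  change T (mk t) = t.eval M.map
  induction t with
  | of s => exact htmul s
  | zero => exact T.map_zero
  | add s t hs ht =>
    exact (T.map_add (mk s) (mk t)).trans (congrArg₂ (· + ·) hs ht)
  | smul c t ht => exact (T.map_smul c (mk t)).trans (congrArg (c • ·) ht)
  | sup s t hs ht =>
    exact (hsup (mk s) (mk t)).trans (congrArg₂ (· ⊔ ·) hs ht)

end RieszTensor

end RieszTensor

/-! ### The positive projective norm and the completion -/

section PositiveProjective

set_option linter.unusedSectionVars false

variable {ι : Type} [Fintype ι] {E : ι → Type u} [∀ i, NormedAddCommGroup (E i)]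
  [∀ i, NormedSpace ℝ (E i)] [∀ i, Lattice (E i)]

namespace RieszTensor

/-- The numbers `∑ k, ∏ i, ‖y k i‖`, where the `y k` are finitely many tuples of positive vectors
with `|a| ≤ ∑ k, ⊗ i, y k i`. -/
def dominatingSums (a : RieszTensor E) : Set ℝ :=
  {r | ∃ (m : ℕ) (y : Fin m → ∀ i, E i), (∀ k i, 0 ≤ y k i) ∧
    |a| ≤ ∑ k, tmul (y k) ∧ r = ∑ k, ∏ i, ‖y k i‖}

/-- The positive projective norm on the Riesz space tensor product. -/
noncomputable def posProjNorm (a : RieszTensor E) : ℝ := sInf (dominatingSums a)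

theorem dominatingSums_nonneg {a : RieszTensor E} {r : ℝ} (h : r ∈ dominatingSums a) : 0 ≤ r := by
  obtain ⟨m, y, -, -, rfl⟩ := h
  exact Finset.sum_nonneg (fun k _ => Finset.prod_nonneg (fun i _ => norm_nonneg _))

theorem dominatingSums_bddBelow (a : RieszTensor E) : BddBelow (dominatingSums a) :=
  ⟨0, fun _ h => dominatingSums_nonneg h⟩

theorem dominatingSums_add {a b : RieszTensor E} {r s : ℝ} (ha : r ∈ dominatingSums a)
    (hb : s ∈ dominatingSums b) {c : RieszTensor E} (hc : |c| ≤ |a| + |b|) :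
    r + s ∈ dominatingSums c := by
  obtain ⟨m, y, hy, hya, rfl⟩ := ha
  obtain ⟨l, z, hz, hzb, rfl⟩ := hb
  refine ⟨m + l, Fin.append y z, fun k => ?_, ?_, ?_⟩
  · refine Fin.addCases (fun k => ?_) (fun k => ?_) k
    · simpa using hy k
    · simpa using hz k
  · rw [Fin.sum_univ_add]
    simp only [Fin.append_left, Fin.append_right]
    exact hc.trans (add_le_add hya hzb)
  · rw [Fin.sum_univ_add]
    simp only [Fin.append_left, Fin.append_right]

theorem dominatingSums_zero : (0 : ℝ) ∈ dominatingSums (0 : RieszTensor E) :=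
  ⟨0, fun k => k.elim0, fun k => k.elim0, by simp, by simp⟩

theorem abs_smul_le (c : ℝ) (a : RieszTensor E) : |c • a| ≤ |c| • |a| := by
  have key : ∀ (d : ℝ) (b : RieszTensor E), d • b ≤ |d| • |b| := by
    intro d b
    rcases le_total 0 d with hd | hd
    · rw [abs_of_nonneg hd]
      exact smul_le_smul_of_nonneg_left (le_abs_self b) hd
    · rw [abs_of_nonpos hd, ← neg_smul_neg d b]
      exact smul_le_smul_of_nonneg_left (neg_le_abs b) (neg_nonneg.mpr hd)
  refine sup_le (key c a) ?_
  rw [← neg_smul]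
  simpa using key (-c) a

variable [Nonempty ι]

theorem dominatingSums_smul {a : RieszTensor E} {r : ℝ} [∀ i, IsOrderedModule ℝ (E i)] (c : ℝ)
    (h : r ∈ dominatingSums a) : |c| * r ∈ dominatingSums (c • a) := by
  classical
  obtain ⟨m, y, hy, hya, rfl⟩ := h
  obtain ⟨i₀⟩ := ‹Nonempty ι›
  refine ⟨m, fun k => Function.update (y k) i₀ (|c| • y k i₀), fun k i => ?_, ?_, ?_⟩
  · rcases eq_or_ne i i₀ with rfl | hi
    · simpa using smul_nonneg (abs_nonneg c) (hy k i)
    · simpa [hi] using hy k i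
  · simp only [MultilinearMap.map_update_smul, Function.update_eq_self, ← Finset.smul_sum]
    exact (abs_smul_le c a).trans (smul_le_smul_of_nonneg_left hya (abs_nonneg c))
  · rw [Finset.mul_sum]
    refine Finset.sum_congr rfl (fun k _ => ?_)
    rw [← Finset.mul_prod_erase _ _ (Finset.mem_univ i₀),
      ← Finset.mul_prod_erase _ (fun i => ‖Function.update (y k) i₀ (|c| • y k i₀) i‖)
        (Finset.mem_univ i₀)]
    rw [Function.update_self, norm_smul, Real.norm_eq_abs, abs_abs, mul_assoc]
    congr 2
    refine Finset.prod_congr rfl (fun i hi => ?_)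
    rw [Function.update_of_ne (Finset.ne_of_mem_erase hi)]

theorem tmul_nonneg {x : ∀ i, E i} (hx : ∀ i, 0 ≤ x i) : 0 ≤ tmul x := by
  classical
  obtain ⟨i₀⟩ := ‹Nonempty ι›
  have h := isRieszMultimorphism_tmul x i₀ (x i₀) 0 (fun j _ => hx j)
  rw [sup_eq_left.mpr (hx i₀), Function.update_eq_self, MultilinearMap.map_update_zero] at h
  rw [h]
  exact le_sup_right

variable [∀ i, IsOrderedAddMonoid (E i)] [∀ i, IsOrderedModule ℝ (E i)]

theorem dominatingSums_tmul (x : ∀ i, E i) : (dominatingSums (tmul x)).Nonempty := by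
  classical
  have hpos : ∀ y : ∀ i, E i, (∀ i, 0 ≤ y i) → (dominatingSums (tmul y)).Nonempty := by
    intro y hy
    exact ⟨_, 1, fun _ => y, fun _ => hy, by simp [abs_of_nonneg (tmul_nonneg hy)], rfl⟩
  have hsum : ∀ (t : Finset (Finset ι)) (f : Finset ι → RieszTensor E),
      (∀ s, (dominatingSums (f s)).Nonempty) → (dominatingSums (∑ s ∈ t, f s)).Nonempty := by
    intro t f hf
    induction t using Finset.induction_on with
    | empty => exact ⟨0, by simpa using dominatingSums_zero⟩
    | insert s t hs ih =>
      rw [Finset.sum_insert hs]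
      obtain ⟨p, hp⟩ := hf s
      obtain ⟨q, hq⟩ := ih
      exact ⟨p + q, dominatingSums_add hp hq (abs_add_le _ _)⟩
  have hx : x = (fun i => (-1 : ℝ) • (x i)⁻) + fun i => (x i)⁺ := by
    funext i
    simp only [Pi.add_apply, neg_smul, one_smul]
    rw [neg_add_eq_sub, posPart_sub_negPart]
  rw [hx, MultilinearMap.map_add_univ]
  refine hsum _ _ (fun s => ?_)
  have hs : s.piecewise (fun i => (-1 : ℝ) • (x i)⁻) (fun i => (x i)⁺) =
      s.piecewise (fun i => (-1 : ℝ) • (s.piecewise (fun i => (x i)⁻) (fun i => (x i)⁺)) i)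
        (s.piecewise (fun i => (x i)⁻) (fun i => (x i)⁺)) := by
    funext i
    by_cases hi : i ∈ s <;> simp [hi]
  rw [hs, MultilinearMap.map_piecewise_smul]
  obtain ⟨p, hp⟩ := hpos (s.piecewise (fun i => (x i)⁻) (fun i => (x i)⁺)) (fun i => by
    by_cases hi : i ∈ s
    · simp [hi]
    · simp [hi])
  exact ⟨_, dominatingSums_smul _ hp⟩

theorem dominatingSums_nonempty (a : RieszTensor E) : (dominatingSums a).Nonempty := by
  obtain ⟨t, rfl⟩ := mk_surjective a
  induction t with
  | of x => exact dominatingSums_tmul x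
  | zero => exact ⟨0, dominatingSums_zero⟩
  | add s t hs ht =>
    obtain ⟨p, hp⟩ := hs
    obtain ⟨q, hq⟩ := ht
    exact ⟨p + q, dominatingSums_add hp hq (abs_add_le (mk s) (mk t))⟩
  | smul c t ht =>
    obtain ⟨p, hp⟩ := ht
    exact ⟨_, dominatingSums_smul c hp⟩
  | sup s t hs ht =>
    obtain ⟨p, hp⟩ := hs
    obtain ⟨q, hq⟩ := ht
    have h : |mk s ⊔ mk t| ≤ |mk s| + |mk t| := by
      refine sup_le (sup_le ?_ ?_) ?_
      · exact (le_abs_self _).trans (le_add_of_nonneg_right (abs_nonneg _))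
      · exact (le_abs_self _).trans (le_add_of_nonneg_left (abs_nonneg _))
      · exact (neg_le_neg le_sup_left).trans
          ((neg_le_abs _).trans (le_add_of_nonneg_right (abs_nonneg _)))
    exact ⟨p + q, dominatingSums_add hp hq h⟩

theorem posProjNorm_nonneg (a : RieszTensor E) : 0 ≤ posProjNorm a :=
  Real.sInf_nonneg (fun _ h => dominatingSums_nonneg h)

theorem posProjNorm_zero : posProjNorm (0 : RieszTensor E) = 0 :=
  le_antisymm (csInf_le (dominatingSums_bddBelow _) dominatingSums_zero) (posProjNorm_nonneg _)

theorem posProjNorm_neg (a : RieszTensor E) : posProjNorm (-a) = posProjNorm a := by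
  unfold posProjNorm dominatingSums
  rw [abs_neg]

theorem posProjNorm_add_le (a b : RieszTensor E) :
    posProjNorm (a + b) ≤ posProjNorm a + posProjNorm b := by
  refine le_of_forall_pos_le_add (fun ε hε => ?_)
  obtain ⟨r, hr, hr'⟩ := Real.lt_sInf_add_pos (dominatingSums_nonempty a) (half_pos hε)
  obtain ⟨s, hs, hs'⟩ := Real.lt_sInf_add_pos (dominatingSums_nonempty b) (half_pos hε)
  have h := csInf_le (dominatingSums_bddBelow _) (dominatingSums_add hr hs (abs_add_le a b))
  unfold posProjNorm
  linarith

theorem posProjNorm_smul_le (c : ℝ) (a : RieszTensor E) :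
    posProjNorm (c • a) ≤ |c| * posProjNorm a := by
  rcases (abs_nonneg c).eq_or_lt with hc | hc
  · rw [← hc, zero_mul, abs_eq_zero.mp hc.symm, zero_smul, posProjNorm_zero]
  · rw [mul_comm, ← div_le_iff₀ hc]
    refine le_csInf (dominatingSums_nonempty a) (fun r hr => ?_)
    rw [div_le_iff₀ hc, mul_comm]
    exact csInf_le (dominatingSums_bddBelow _) (dominatingSums_smul c hr)

noncomputable instance : SeminormedAddCommGroup (RieszTensor E) :=
  AddGroupSeminorm.toSeminormedAddCommGroup
    { toFun := posProjNorm
      map_zero' := posProjNorm_zero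
      add_le' := posProjNorm_add_le
      neg' := posProjNorm_neg }

theorem norm_def (a : RieszTensor E) : ‖a‖ = posProjNorm a := rfl

noncomputable instance : NormedSpace ℝ (RieszTensor E) where
  norm_smul_le := posProjNorm_smul_le

end RieszTensor

variable [Nonempty ι] [∀ i, IsOrderedAddMonoid (E i)] [∀ i, IsOrderedModule ℝ (E i)]

variable (E) in
/-- The Fremlin positive projective tensor product: the completion of the Riesz space tensor
product with respect to the positive projective norm. -/
abbrev FremlinTensor : Type u := UniformSpace.Completion (RieszTensor E)

/-- The elementary tensor `⊗ i, x i` in the Fremlin positive projective tensor product. -/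
noncomputable def fremlinTmul (x : ∀ i, E i) : FremlinTensor E :=
  ((RieszTensor.tmul x : RieszTensor E) : UniformSpace.Completion (RieszTensor E))

end PositiveProjective

/-! Each factor supplies a positive, pairwise disjoint, weakly null sequence bounded away from zero
in norm (`exists_disjoint_weaklyNull_of_not_positiveSchur`). The tensors of these sequences do the
job.

Weak nullity: a functional on the tensor product is a bounded multilinear form `Φ`. Freezing all
variables but the last gives functionals `f j` with value `f j (x j)` at the last sequence. By
induction on the number of factors, applied to `ψ ∘ Φ` for `ψ` in the bidual, `f` is weakly null in
the dual. So `y ↦ (f j y)` is a weakly compact operator into `c₀`, and the weak Dunford-Pettis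
property gives `f j (x j) → 0`.

No norm nullity: the norm of a positive elementary tensor is at least the product of the norms
(`prod_norm_le_of_tmul_le`). Real lattice homomorphisms on a principal ideal determine its order,
and their products form a Riesz multimorphism into an Archimedean lattice of germs. Hence domination
by a sum of tensors becomes a numerical inequality between products of homomorphism values. The
homomorphisms are then traded for norms one coordinate at a time.

The disjoint sequence: if pairwise infima tend to zero in norm, subtracting a small vector from a
subsequence makes it disjoint. Otherwise infima with a fixed term give a weakly null, non-null
sequence in an order interval. If that interval held no disjoint sequence bounded away from zero,
its monotone sequences would converge in norm, which is contradictory. -/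

/-! ### Real lattice homomorphisms on principal ideals -/

section PrincipalIdeal

set_option linter.unusedSectionVars false

variable {E : Type*} [AddCommGroup E] [Module ℝ E] [Lattice E] [IsOrderedAddMonoid E]
  [IsOrderedModule ℝ E]

theorem abs_smul_le_smul_abs (c : ℝ) (a : E) : |c • a| ≤ |c| • |a| := by
  have key : ∀ (d : ℝ) (b : E), d • b ≤ |d| • |b| := by
    intro d b
    rcases le_total 0 d with hd | hd
    · rw [abs_of_nonneg hd]
      exact smul_le_smul_of_nonneg_left (le_abs_self b) hd
    · rw [abs_of_nonpos hd, ← neg_smul_neg d b]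
      exact smul_le_smul_of_nonneg_left (neg_le_abs b) (neg_nonneg.mpr hd)
  refine sup_le (key c a) ?_
  rw [← neg_smul]
  simpa using key (-c) a

/-- The ideal generated by `z`. -/
def principalIdeal (z : E) : Submodule ℝ E where
  carrier := {x | ∃ t : ℝ, |x| ≤ t • |z|}
  zero_mem' := ⟨0, by simp⟩
  add_mem' := by
    rintro x y ⟨s, hs⟩ ⟨t, ht⟩
    exact ⟨s + t, (abs_add_le x y).trans (by rw [add_smul]; exact add_le_add hs ht)⟩
  smul_mem' := by
    rintro c x ⟨s, hs⟩
    refine ⟨|c| * s, (abs_smul_le_smul_abs c x).trans ?_⟩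
    rw [mul_smul]
    exact smul_le_smul_of_nonneg_left hs (abs_nonneg c)

theorem mem_principalIdeal_of_abs_le {z x y : E} (hy : y ∈ principalIdeal z) (h : |x| ≤ |y|) :
    x ∈ principalIdeal z := by
  obtain ⟨t, ht⟩ := hy
  exact ⟨t, h.trans ht⟩

theorem abs_mem_principalIdeal {z x : E} (hx : x ∈ principalIdeal z) : |x| ∈ principalIdeal z :=
  mem_principalIdeal_of_abs_le hx (by rw [abs_abs])

theorem self_mem_principalIdeal (z : E) : z ∈ principalIdeal z := ⟨1, by simp⟩

theorem sup_mem_principalIdeal {z x y : E} (hx : x ∈ principalIdeal z)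
    (hy : y ∈ principalIdeal z) : x ⊔ y ∈ principalIdeal z := by
  refine mem_principalIdeal_of_abs_le
    (add_mem (abs_mem_principalIdeal hx) (abs_mem_principalIdeal hy)) ?_
  refine le_trans ?_ (le_abs_self _)
  refine sup_le (sup_le ?_ ?_) ?_
  · exact (le_abs_self _).trans (le_add_of_nonneg_right (abs_nonneg _))
  · exact (le_abs_self _).trans (le_add_of_nonneg_left (abs_nonneg _))
  · exact (neg_le_neg le_sup_left).trans
      ((neg_le_abs _).trans (le_add_of_nonneg_right (abs_nonneg _)))

theorem principalIdeal_mono {z w : E} (h : z ∈ principalIdeal w) :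
    principalIdeal z ≤ principalIdeal w := by
  rintro x ⟨t, ht⟩
  obtain ⟨s, hs⟩ := h
  refine ⟨|t| * s, ht.trans ?_⟩
  rw [mul_smul]
  exact (smul_le_smul_of_nonneg_right (le_abs_self t) (abs_nonneg z)).trans
    (smul_le_smul_of_nonneg_left hs (abs_nonneg t))

/-- The restriction of `κ` to the ideal generated by `z` is a linear lattice homomorphism. -/
structure IsIdealHom (z : E) (κ : E → ℝ) : Prop where
  map_add : ∀ x ∈ principalIdeal z, ∀ y ∈ principalIdeal z, κ (x + y) = κ x + κ y
  map_smul : ∀ (c : ℝ), ∀ x ∈ principalIdeal z, κ (c • x) = c * κ x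
  map_sup : ∀ x ∈ principalIdeal z, ∀ y ∈ principalIdeal z, κ (x ⊔ y) = κ x ⊔ κ y

theorem IsIdealHom.mono {z w : E} {κ : E → ℝ} (hκ : IsIdealHom w κ)
    (h : z ∈ principalIdeal w) : IsIdealHom z κ :=
  ⟨fun x hx y hy => hκ.1 x (principalIdeal_mono h hx) y (principalIdeal_mono h hy),
    fun c x hx => hκ.2 c x (principalIdeal_mono h hx),
    fun x hx y hy => hκ.3 x (principalIdeal_mono h hx) y (principalIdeal_mono h hy)⟩

theorem IsIdealHom.map_zero {z : E} {κ : E → ℝ} (hκ : IsIdealHom z κ) : κ 0 = 0 := by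
  simpa using hκ.map_smul 0 0 (zero_mem _)

theorem IsIdealHom.nonneg {z x : E} {κ : E → ℝ} (hκ : IsIdealHom z κ)
    (hx : x ∈ principalIdeal z) (h : 0 ≤ x) : 0 ≤ κ x := by
  have := hκ.map_sup x hx 0 (zero_mem _)
  rw [sup_eq_left.mpr h, hκ.map_zero] at this
  rw [this]
  exact le_sup_right

theorem IsIdealHom.le_of_le {z x y : E} {κ : E → ℝ} (hκ : IsIdealHom z κ)
    (hx : x ∈ principalIdeal z) (hy : y ∈ principalIdeal z) (h : x ≤ y) : κ x ≤ κ y := by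
  have := hκ.map_sup x hx y hy
  rw [sup_eq_right.mpr h] at this
  rw [this]
  exact le_sup_left

theorem IsIdealHom.map_sum {z : E} {κ : E → ℝ} (hκ : IsIdealHom z κ) {α : Type*} {v : α → E}
    (hv : ∀ k, v k ∈ principalIdeal z) (s : Finset α) : κ (∑ k ∈ s, v k) = ∑ k ∈ s, κ (v k) := by
  classical
  induction s using Finset.induction_on with
  | empty => simpa using hκ.map_zero
  | insert k s hk ih =>
    rw [Finset.sum_insert hk, Finset.sum_insert hk,
      hκ.map_add _ (hv k) _ (Submodule.sum_mem _ fun l _ => hv l), ih]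

/-- A real function whose restriction to the ideal generated by `z` is sublinear and preserves
binary suprema. -/
structure IsSupSublinear (z : E) (q : E → ℝ) : Prop where
  add_le : ∀ x ∈ principalIdeal z, ∀ y ∈ principalIdeal z, q (x + y) ≤ q x + q y
  smul_le : ∀ (c : ℝ), 0 < c → ∀ x ∈ principalIdeal z, q (c • x) ≤ c * q x
  map_sup : ∀ x ∈ principalIdeal z, ∀ y ∈ principalIdeal z, q (x ⊔ y) = q x ⊔ q y

/-! ### Minimal sup-preserving sublinear functions are linear -/

namespace IsSupSublinear

variable {z : E} {q : E → ℝ}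

theorem mono (hq : IsSupSublinear z q) {x y : E} (hx : x ∈ principalIdeal z)
    (hy : y ∈ principalIdeal z) (h : x ≤ y) : q x ≤ q y := by
  have := hq.map_sup x hx y hy
  rw [sup_eq_right.mpr h] at this
  rw [this]
  exact le_sup_left

theorem map_zero (hq : IsSupSublinear z q) : q 0 = 0 := by
  -- The factor 2 gives `0 ≤ q 0`, the factor 1/2 gives `q 0 ≤ 0`.
  have h1 := hq.smul_le 2 two_pos 0 (zero_mem _)
  have h2 := hq.smul_le (1 / 2) (by norm_num) 0 (zero_mem _)
  rw [smul_zero] at h1 h2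
  linarith

theorem map_smul (hq : IsSupSublinear z q) {c : ℝ} (hc : 0 ≤ c) {x : E}
    (hx : x ∈ principalIdeal z) : q (c • x) = c * q x := by
  rcases hc.eq_or_lt with rfl | hc
  · simp [hq.map_zero]
  refine le_antisymm (hq.smul_le c hc x hx) ?_
  have h := hq.smul_le c⁻¹ (inv_pos.mpr hc) (c • x) (Submodule.smul_mem _ c hx)
  rw [inv_smul_smul₀ hc.ne'] at h
  calc c * q x ≤ c * (c⁻¹ * q (c • x)) := mul_le_mul_of_nonneg_left h hc.le
    _ = q (c • x) := by field_simp

theorem neg_le (hq : IsSupSublinear z q) {x : E} (hx : x ∈ principalIdeal z) :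
    -q (-x) ≤ q x := by
  have h := hq.add_le x hx (-x) (neg_mem hx)
  rw [add_neg_cancel, hq.map_zero] at h
  linarith

/-- The directional regularization `x ↦ inf_{t ≥ 0} (q (x + t a) - t q a)`. -/
noncomputable def directional (q : E → ℝ) (a x : E) : ℝ :=
  ⨅ t : NNReal, (q (x + (t : ℝ) • a) - t * q a)

theorem bddBelow_directional (hq : IsSupSublinear z q) {a : E}
    (ha : a ∈ principalIdeal z) {x : E} (hx : x ∈ principalIdeal z) :
    BddBelow (Set.range fun t : NNReal => q (x + (t : ℝ) • a) - t * q a) := by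
  refine ⟨-q (-x), ?_⟩
  rintro _ ⟨t, rfl⟩
  have hta : (t : ℝ) • a ∈ principalIdeal z := Submodule.smul_mem _ _ ha
  have h := hq.add_le (x + (t : ℝ) • a) (add_mem hx hta) (-x) (neg_mem hx)
  rw [add_neg_cancel_comm, hq.map_smul t.coe_nonneg ha] at h
  dsimp only
  linarith

theorem directional_le (hq : IsSupSublinear z q) {a : E}
    (ha : a ∈ principalIdeal z) {x : E} (hx : x ∈ principalIdeal z) (t : NNReal) :
    directional q a x ≤ q (x + (t : ℝ) • a) - t * q a :=
  ciInf_le (hq.bddBelow_directional ha hx) t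

theorem directional_le_self (hq : IsSupSublinear z q) {a : E}
    (ha : a ∈ principalIdeal z) {x : E} (hx : x ∈ principalIdeal z) : directional q a x ≤ q x := by
  simpa using hq.directional_le ha hx 0

/-- The parameter `t = 1` suffices. This estimate makes a minimal function odd, hence linear. -/
theorem directional_neg_le (hq : IsSupSublinear z q) {a : E} (ha : a ∈ principalIdeal z) :
    directional q a (-a) ≤ -q a := by
  simpa [hq.map_zero] using hq.directional_le ha (neg_mem ha) 1

/-- Subadditivity applied to the increment `(t - s) • a`. Monotonicity in the parameter is what lets
the infimum commute with binary suprema. -/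
theorem directional_antitone (hq : IsSupSublinear z q) {a : E}
    (ha : a ∈ principalIdeal z) {x : E} (hx : x ∈ principalIdeal z) :
    Antitone fun t : NNReal => q (x + (t : ℝ) • a) - t * q a := by
  intro s t hst
  have hs : (s : ℝ) • a ∈ principalIdeal z := Submodule.smul_mem _ _ ha
  have hst' : (0 : ℝ) ≤ t - s := sub_nonneg.mpr hst
  have h := hq.add_le (x + (s : ℝ) • a) (add_mem hx hs) (((t : ℝ) - s) • a)
    (Submodule.smul_mem _ _ ha)
  rw [hq.map_smul hst' ha, add_assoc, ← add_smul, add_sub_cancel] at h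
  dsimp only
  linarith

theorem isSupSublinear_directional (hq : IsSupSublinear z q) {a : E}
    (ha : a ∈ principalIdeal z) : IsSupSublinear z (directional q a) where
  add_le x hx y hy := by
    refine le_of_forall_pos_le_add fun ε hε => ?_
    obtain ⟨s, hs⟩ := exists_lt_of_ciInf_lt
      (lt_add_of_pos_right (directional q a x) (half_pos hε))
    obtain ⟨t, ht⟩ := exists_lt_of_ciInf_lt
      (lt_add_of_pos_right (directional q a y) (half_pos hε))
    have hsa : (s : ℝ) • a ∈ principalIdeal z := Submodule.smul_mem _ _ ha
    have hta : (t : ℝ) • a ∈ principalIdeal z := Submodule.smul_mem _ _ ha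
    have h1 := hq.directional_le ha (add_mem hx hy) (s + t)
    have h2 := hq.add_le _ (add_mem hx hsa) _ (add_mem hy hta)
    rw [add_add_add_comm, ← add_smul] at h2
    push_cast at h1
    linarith
  smul_le c hc x hx := by
    rw [← div_le_iff₀' hc]
    refine le_ciInf fun t => ?_
    rw [div_le_iff₀' hc]
    have h1 := hq.directional_le ha (Submodule.smul_mem _ c hx) (⟨c, hc.le⟩ * t)
    have hta : (t : ℝ) • a ∈ principalIdeal z := Submodule.smul_mem _ _ ha
    have h2 := hq.smul_le c hc _ (add_mem hx hta)
    rw [smul_add, smul_smul] at h2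
    have hct : ((⟨c, hc.le⟩ * t : NNReal) : ℝ) = c * t := rfl
    rw [hct] at h1
    linarith
  map_sup x hx y hy := by
    have hmem : ∀ t : NNReal, (t : ℝ) • a ∈ principalIdeal z := fun t =>
      Submodule.smul_mem _ _ ha
    have hsup : ∀ t : NNReal, q (x ⊔ y + (t : ℝ) • a) - t * q a =
        (q (x + (t : ℝ) • a) - t * q a) ⊔ (q (y + (t : ℝ) • a) - t * q a) := by
      intro t
      rw [sup_add, hq.map_sup _ (add_mem hx (hmem t)) _ (add_mem hy (hmem t)), sup_sub]
    refine le_antisymm ?_ (sup_le ?_ ?_)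
    · refine le_of_forall_pos_le_add fun ε hε => ?_
      obtain ⟨s, hs⟩ := exists_lt_of_ciInf_lt
        (lt_add_of_pos_right (directional q a x) hε)
      obtain ⟨t, ht⟩ := exists_lt_of_ciInf_lt
        (lt_add_of_pos_right (directional q a y) hε)
      -- At the larger parameter both infima are approximated at once.
      have h1 := hq.directional_le ha (sup_mem_principalIdeal hx hy) (s ⊔ t)
      rw [hsup] at h1
      refine h1.trans (sup_le ?_ ?_)
      · have := hq.directional_antitone ha hx (le_sup_left : s ≤ s ⊔ t)
        dsimp only at this
        linarith [le_max_left (directional q a x) (directional q a y)]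
      · have := hq.directional_antitone ha hy (le_sup_right : t ≤ s ⊔ t)
        dsimp only at this
        linarith [le_max_right (directional q a x) (directional q a y)]
    · refine le_ciInf fun t => (hq.directional_le ha hx t).trans ?_
      rw [hsup]
      exact le_sup_left
    · refine le_ciInf fun t => (hq.directional_le ha hy t).trans ?_
      rw [hsup]
      exact le_sup_right

/-- A pointwise infimum over a nonempty chain of functions that preserve suprema and are sublinear
has these properties again. -/
theorem iInf_chain {ι : Type*} [Nonempty ι] {f : ι → E → ℝ} (hf : ∀ i, IsSupSublinear z (f i))
    (hchain : ∀ i j, ∃ k, ∀ x ∈ principalIdeal z, f k x ≤ f i x ∧ f k x ≤ f j x)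
    (hbdd : ∀ x ∈ principalIdeal z, BddBelow (Set.range fun i => f i x)) :
    IsSupSublinear z fun x => ⨅ i, f i x where
  add_le x hx y hy := by
    refine le_of_forall_pos_le_add fun ε hε => ?_
    obtain ⟨i, hi⟩ := exists_lt_of_ciInf_lt
      (lt_add_of_pos_right (⨅ i, f i x) (half_pos hε))
    obtain ⟨j, hj⟩ := exists_lt_of_ciInf_lt
      (lt_add_of_pos_right (⨅ i, f i y) (half_pos hε))
    obtain ⟨k, hk⟩ := hchain i j
    have h1 := ciInf_le (hbdd _ (add_mem hx hy)) k
    have h2 := (hf k).add_le x hx y hy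
    have h3 := (hk x hx).1
    have h4 := (hk y hy).2
    linarith
  smul_le c hc x hx := by
    rw [← div_le_iff₀' hc]
    refine le_ciInf fun i => ?_
    rw [div_le_iff₀' hc]
    exact (ciInf_le (hbdd _ (Submodule.smul_mem _ c hx)) i).trans ((hf i).smul_le c hc x hx)
  map_sup x hx y hy := by
    refine le_antisymm ?_ (sup_le ?_ ?_)
    · refine le_of_forall_pos_le_add fun ε hε => ?_
      obtain ⟨i, hi⟩ := exists_lt_of_ciInf_lt (lt_add_of_pos_right (⨅ i, f i x) hε)
      obtain ⟨j, hj⟩ := exists_lt_of_ciInf_lt (lt_add_of_pos_right (⨅ i, f i y) hε)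
      obtain ⟨k, hk⟩ := hchain i j
      refine (ciInf_le (hbdd _ (sup_mem_principalIdeal hx hy)) k).trans ?_
      rw [(hf k).map_sup x hx y hy]
      refine sup_le ?_ ?_
      · linarith [(hk x hx).1, le_max_left (⨅ i, f i x) (⨅ i, f i y)]
      · linarith [(hk y hy).2, le_max_right (⨅ i, f i x) (⨅ i, f i y)]
    · refine le_ciInf fun i => (ciInf_le (hbdd x hx) i).trans ?_
      exact (hf i).mono hx (sup_mem_principalIdeal hx hy) le_sup_left
    · refine le_ciInf fun i => (ciInf_le (hbdd y hy) i).trans ?_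
      exact (hf i).mono hy (sup_mem_principalIdeal hx hy) le_sup_right

/-- Below every sublinear function preserving suprema there is a linear one. -/
theorem exists_isIdealHom_le (hq : IsSupSublinear z q) :
    ∃ κ : E → ℝ, IsIdealHom z κ ∧ ∀ x ∈ principalIdeal z, κ x ≤ q x := by
  let P := {p : E → ℝ // IsSupSublinear z p ∧ ∀ x ∈ principalIdeal z, p x ≤ q x}
  -- The order is reversed: a maximal element for `r` is a minimal function.
  let r : P → P → Prop := fun p p' => ∀ x ∈ principalIdeal z, p'.1 x ≤ p.1 x
  have hbdd : ∀ (c : Set P), ∀ x ∈ principalIdeal z,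
      BddBelow (Set.range fun p : c => p.1.1 x) := by
    intro c x hx
    refine ⟨-q (-x), ?_⟩
    rintro _ ⟨p, rfl⟩
    exact (neg_le_neg (p.1.2.2 _ (neg_mem hx))).trans (p.1.2.1.neg_le hx)
  obtain ⟨m, hm⟩ := exists_maximal_of_chains_bounded (r := r) (fun c hc => by
    rcases c.eq_empty_or_nonempty with rfl | hne
    · exact ⟨⟨q, hq, fun _ _ => le_rfl⟩, by simp⟩
    have : Nonempty c := hne.to_subtype
    refine ⟨⟨fun x => ⨅ p : c, p.1.1 x, iInf_chain (fun p => p.1.2.1) ?_ (hbdd c), ?_⟩, ?_⟩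
    · intro i j
      rcases eq_or_ne i j with rfl | hij
      · exact ⟨i, fun _ _ => ⟨le_rfl, le_rfl⟩⟩
      rcases hc i.2 j.2 (fun h => hij (Subtype.ext h)) with h | h
      · exact ⟨j, fun x hx => ⟨h x hx, le_rfl⟩⟩
      · exact ⟨i, fun x hx => ⟨le_rfl, h x hx⟩⟩
    · intro x hx
      obtain ⟨p, hp⟩ := hne
      exact (ciInf_le (hbdd c x hx) ⟨p, hp⟩).trans (p.2.2 x hx)
    · intro p hp x hx
      exact ciInf_le (hbdd c x hx) ⟨p, hp⟩)
    (fun {a b c} hab hbc x hx => (hbc x hx).trans (hab x hx))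
  obtain ⟨p, hp, hpq⟩ := m
  have hneg : ∀ a ∈ principalIdeal z, p (-a) = -p a := by
    intro a ha
    refine le_antisymm ?_ ?_
    -- By minimality `p` lies below its own regularization in direction `a`, whose value at `-a` is
    -- at most `-p a`.
    · refine (hm ⟨directional p a, hp.isSupSublinear_directional ha, fun x hx =>
        (hp.directional_le_self ha hx).trans (hpq x hx)⟩
        (fun x hx => hp.directional_le_self ha hx) (-a) (neg_mem ha)).trans ?_
      exact hp.directional_neg_le ha
    · have := hp.neg_le (neg_mem ha)
      rwa [neg_neg] at this
  refine ⟨p, ⟨?_, ?_, hp.map_sup⟩, hpq⟩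
  · intro x hx y hy
    refine le_antisymm (hp.add_le x hx y hy) ?_
    have h := hp.add_le (x + y) (add_mem hx hy) (-y) (neg_mem hy)
    rw [add_neg_cancel_right, hneg y hy] at h
    linarith
  · intro c x hx
    rcases le_total 0 c with hc | hc
    · exact hp.map_smul hc hx
    · have h := hp.map_smul (neg_nonneg.mpr hc) hx
      rw [neg_smul, hneg _ (Submodule.smul_mem _ c hx)] at h
      linarith

end IsSupSublinear

/-! ### The gauge of a principal ideal -/

/-- The gauge `x ↦ inf {t | x ≤ t |z|}`. -/
noncomputable def upperGauge (z x : E) : ℝ := sInf {t : ℝ | x ≤ t • |z|}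

section Gauge

variable {z : E}

theorem abs_pos_of_ne (hz : z ≠ 0) : 0 < |z| := by
  refine lt_of_le_of_ne (abs_nonneg z) fun h => hz ?_
  have h1 := le_abs_self z
  have h2 := neg_le_abs z
  rw [← h] at h1 h2
  exact le_antisymm h1 (neg_nonpos.mp h2)

theorem smul_abs_le_smul_abs_iff (hz : z ≠ 0) {s t : ℝ} : s • |z| ≤ t • |z| ↔ s ≤ t := by
  refine ⟨fun h => ?_, fun h => smul_le_smul_of_nonneg_right h (abs_nonneg z)⟩
  by_contra! hts
  have h1 : (s - t) • |z| ≤ 0 := by rw [sub_smul]; exact sub_nonpos.mpr h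
  have h2 : |z| ≤ 0 := by
    have := smul_le_smul_of_nonneg_left h1 (inv_nonneg.mpr (sub_pos.mpr hts).le)
    rwa [inv_smul_smul₀ (sub_pos.mpr hts).ne', smul_zero] at this
  exact absurd (abs_pos_of_ne hz) h2.not_gt

theorem bddBelow_upperGauge (hz : z ≠ 0) {x : E} (hx : x ∈ principalIdeal z) :
    BddBelow {t : ℝ | x ≤ t • |z|} := by
  obtain ⟨s, hs⟩ := hx
  refine ⟨-s, fun t ht => ?_⟩
  rw [← smul_abs_le_smul_abs_iff hz, neg_smul]
  exact (neg_le.mp ((neg_le_abs x).trans hs)).trans ht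

theorem upperGauge_le (hz : z ≠ 0) {x : E} (hx : x ∈ principalIdeal z) {t : ℝ} (h : x ≤ t • |z|) :
    upperGauge z x ≤ t := csInf_le (bddBelow_upperGauge hz hx) h

theorem le_smul_of_upperGauge_lt {x : E} (hx : x ∈ principalIdeal z) {t : ℝ}
    (h : upperGauge z x < t) : x ≤ t • |z| := by
  obtain ⟨u, hu⟩ := hx
  obtain ⟨s, hs, hst⟩ := exists_lt_of_csInf_lt ⟨u, (le_abs_self x).trans hu⟩ h
  exact le_trans hs (smul_le_smul_of_nonneg_right hst.le (abs_nonneg z))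

theorem isSupSublinear_upperGauge (hz : z ≠ 0) : IsSupSublinear z (upperGauge z) where
  add_le x hx y hy := by
    refine le_of_forall_pos_le_add fun ε hε => ?_
    have h1 := le_smul_of_upperGauge_lt hx (lt_add_of_pos_right _ (half_pos hε))
    have h2 := le_smul_of_upperGauge_lt hy (lt_add_of_pos_right _ (half_pos hε))
    have h := upperGauge_le hz (add_mem hx hy) ((add_le_add h1 h2).trans_eq (add_smul _ _ _).symm)
    linarith
  smul_le c hc x hx := by
    refine le_of_forall_pos_le_add fun ε hε => ?_
    have h1 := le_smul_of_upperGauge_lt hx (lt_add_of_pos_right _ (div_pos hε hc))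
    have h := upperGauge_le hz (Submodule.smul_mem _ c hx)
      ((smul_le_smul_of_nonneg_left h1 hc.le).trans_eq (smul_smul _ _ _))
    rwa [mul_add, mul_div_cancel₀ _ hc.ne'] at h
  map_sup x hx y hy := by
    have hxy := sup_mem_principalIdeal hx hy
    refine le_antisymm ?_ (sup_le ?_ ?_)
    · refine le_of_forall_gt_imp_ge_of_dense fun t ht => ?_
      exact upperGauge_le hz hxy (sup_le
        (le_smul_of_upperGauge_lt hx (le_sup_left.trans_lt ht))
        (le_smul_of_upperGauge_lt hy (le_sup_right.trans_lt ht)))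
    · refine le_of_forall_gt_imp_ge_of_dense fun t ht => ?_
      exact upperGauge_le hz hx (le_sup_left.trans (le_smul_of_upperGauge_lt hxy ht))
    · refine le_of_forall_gt_imp_ge_of_dense fun t ht => ?_
      exact upperGauge_le hz hy (le_sup_right.trans (le_smul_of_upperGauge_lt hxy ht))

end Gauge

end PrincipalIdeal

/-! ### Order separation by real lattice homomorphisms -/

section Separation

variable {E : Type*} [NormedAddCommGroup E] [NormedSpace ℝ E] [Lattice E]
  [IsOrderedAddMonoid E] [IsOrderedModule ℝ E] [HasSolidNorm E]

/-- The real lattice homomorphisms on a principal ideal of a normed lattice determine the order. -/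
theorem nonneg_of_forall_isIdealHom {z w : E} (hw : w ∈ principalIdeal z)
    (h : ∀ κ, IsIdealHom z κ → 0 ≤ κ w) : 0 ≤ w := by
  rcases eq_or_ne z 0 with rfl | hz
  · obtain ⟨t, ht⟩ := hw
    rw [abs_zero, smul_zero] at ht
    exact neg_nonpos.mp ((neg_le_abs w).trans ht)
  have hq := isSupSublinear_upperGauge hz
  -- Regularizing in direction `-w` yields a homomorphism below the gauge that satisfies `κ w ≤
  -- -upperGauge z (-w)`.
  obtain ⟨κ, hκ, hle⟩ :=
    (hq.isSupSublinear_directional (neg_mem hw)).exists_isIdealHom_le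
  have h1 : κ w ≤ -upperGauge z (-w) := by
    have := hq.directional_neg_le (neg_mem hw)
    rw [neg_neg] at this
    exact (hle w hw).trans this
  have h2 : upperGauge z (-w) ≤ 0 := by linarith [h κ hκ]
  -- A nonpositive gauge gives `-w ≤ t • |z|` for every `t > 0`; the positive cone is closed, so `t
  -- → 0` is allowed.
  have h3 : ∀ᶠ t : ℝ in 𝓝[>] 0, -w ≤ t • |z| := by
    filter_upwards [self_mem_nhdsWithin] with t ht
    exact le_smul_of_upperGauge_lt (neg_mem hw) (h2.trans_lt ht)
  have h4 : Tendsto (fun t : ℝ => t • |z|) (𝓝[>] 0) (𝓝 ((0 : ℝ) • |z|)) :=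
    (tendsto_nhdsWithin_of_tendsto_nhds (tendsto_id.smul_const _))
  have h5 := ge_of_tendsto h4 h3
  rw [zero_smul] at h5
  exact neg_nonpos.mp h5

theorem le_of_forall_isIdealHom {z x y : E} (hx : x ∈ principalIdeal z)
    (hy : y ∈ principalIdeal z) (h : ∀ κ, IsIdealHom z κ → κ x ≤ κ y) : x ≤ y := by
  rw [← sub_nonneg]
  refine nonneg_of_forall_isIdealHom (sub_mem hy hx) fun κ hκ => ?_
  have h1 := hκ.map_add (y - x) (sub_mem hy hx) x hx
  rw [sub_add_cancel] at h1
  linarith [h κ hκ]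

end Separation

/-! ### A Riesz multimorphism into germs of functions -/

section GermModel

set_option linter.unusedSectionVars false

variable {ι : Type} {E : ι → Type u} [∀ i, NormedAddCommGroup (E i)] [∀ i, NormedSpace ℝ (E i)]
  [∀ i, Lattice (E i)] [∀ i, IsOrderedAddMonoid (E i)] [∀ i, IsOrderedModule ℝ (E i)]

/-- By completeness a weighted series of the `|z n|` converges, and a multiple of its sum dominates
each term. -/
theorem exists_mem_principalIdeal_forall {F : Type*} [NormedAddCommGroup F] [NormedSpace ℝ F]
    [Lattice F] [IsOrderedAddMonoid F] [IsOrderedModule ℝ F] [HasSolidNorm F] [CompleteSpace F]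
    (z : ℕ → F) : ∃ w : F, ∀ n, z n ∈ principalIdeal w := by
  let c : ℕ → ℝ := fun n => (1 / 2) ^ n * (1 + ‖z n‖)⁻¹
  have hc : ∀ n, 0 < c n := fun n => by positivity
  have hs : Summable fun n => c n • |z n| := by
    refine Summable.of_norm_bounded summable_geometric_two fun n => ?_
    rw [norm_smul, norm_abs_eq_norm, Real.norm_eq_abs, abs_of_pos (hc n), mul_assoc]
    refine mul_le_of_le_one_right (by positivity) ?_
    rw [inv_mul_le_one₀ (by positivity)]
    linarith
  have hnn : ∀ n, 0 ≤ c n • |z n| := fun n => smul_nonneg (hc n).le (abs_nonneg _)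
  refine ⟨∑' n, c n • |z n|, fun n => ⟨(c n)⁻¹, ?_⟩⟩
  have h := (hs.le_tsum n fun m _ => hnn m).trans (le_abs_self _)
  have h1 := smul_le_smul_of_nonneg_left h (inv_nonneg.mpr (hc n).le)
  rwa [inv_smul_smul₀ (hc n).ne'] at h1

variable (E) in
/-- The filter on families of functions generated by the families of lattice homomorphisms on
given principal ideals. -/
def idealHomFilter : Filter (∀ i, E i → ℝ) where
  sets := {A | ∃ z : ∀ i, E i, ∀ κ : ∀ i, E i → ℝ, (∀ i, IsIdealHom (z i) (κ i)) → κ ∈ A}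
  univ_sets := ⟨0, fun _ _ => trivial⟩
  sets_of_superset := fun ⟨z, hz⟩ h => ⟨z, fun κ hκ => h (hz κ hκ)⟩
  inter_sets := by
    rintro A B ⟨z, hz⟩ ⟨w, hw⟩
    have h1 : ∀ i, |z i| ≤ |(|z i| + |w i|)| := fun i =>
      (le_add_of_nonneg_right (abs_nonneg _)).trans (le_abs_self _)
    have h2 : ∀ i, |w i| ≤ |(|z i| + |w i|)| := fun i =>
      (le_add_of_nonneg_left (abs_nonneg _)).trans (le_abs_self _)
    exact ⟨fun i => |z i| + |w i|, fun κ hκ =>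
      ⟨hz κ fun i => (hκ i).mono
        (mem_principalIdeal_of_abs_le (self_mem_principalIdeal _) (h1 i)),
      hw κ fun i => (hκ i).mono
        (mem_principalIdeal_of_abs_le (self_mem_principalIdeal _) (h2 i))⟩⟩

theorem eventually_idealHomFilter {p : (∀ i, E i → ℝ) → Prop} :
    (∀ᶠ κ in idealHomFilter E, p κ) ↔
      ∃ z : ∀ i, E i, ∀ κ : ∀ i, E i → ℝ, (∀ i, IsIdealHom (z i) (κ i)) → p κ := Iff.rfl

theorem eventually_isIdealHom (z : ∀ i, E i) :
    ∀ᶠ κ in idealHomFilter E, ∀ i, IsIdealHom (z i) (κ i) := ⟨z, fun _ h => h⟩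

/-- The filter is closed under countable intersections, since countably many generators lie in one
principal ideal. -/
theorem eventually_forall_idealHomFilter [∀ i, HasSolidNorm (E i)] [∀ i, CompleteSpace (E i)]
    {p : ℕ → (∀ i, E i → ℝ) → Prop} (h : ∀ n, ∀ᶠ κ in idealHomFilter E, p n κ) :
    ∀ᶠ κ in idealHomFilter E, ∀ n, p n κ := by
  choose z hz using h
  choose w hw using fun i => exists_mem_principalIdeal_forall fun n => z n i
  exact ⟨w, fun κ hκ n => hz n κ fun i => (hκ i).mono (hw i n)⟩

theorem eventually_map_add (i : ι) (x y : E i) :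
    ∀ᶠ κ in idealHomFilter E, κ i (x + y) = κ i x + κ i y := by
  classical
  filter_upwards [eventually_isIdealHom (Function.update (0 : ∀ i, E i) i (|x| + |y|))] with κ hκ
  have h := hκ i
  rw [Function.update_self] at h
  refine h.map_add x ⟨1, ?_⟩ y ⟨1, ?_⟩
  · rw [one_smul]
    exact (le_add_of_nonneg_right (abs_nonneg _)).trans (le_abs_self _)
  · rw [one_smul]
    exact (le_add_of_nonneg_left (abs_nonneg _)).trans (le_abs_self _)

theorem eventually_map_sup (i : ι) (x y : E i) :
    ∀ᶠ κ in idealHomFilter E, κ i (x ⊔ y) = κ i x ⊔ κ i y := by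
  classical
  filter_upwards [eventually_isIdealHom (Function.update (0 : ∀ i, E i) i (|x| + |y|))] with κ hκ
  have h := hκ i
  rw [Function.update_self] at h
  refine h.map_sup x ⟨1, ?_⟩ y ⟨1, ?_⟩
  · rw [one_smul]
    exact (le_add_of_nonneg_right (abs_nonneg _)).trans (le_abs_self _)
  · rw [one_smul]
    exact (le_add_of_nonneg_left (abs_nonneg _)).trans (le_abs_self _)

theorem eventually_map_smul (i : ι) (c : ℝ) (x : E i) :
    ∀ᶠ κ in idealHomFilter E, κ i (c • x) = c * κ i x := by
  classical
  filter_upwards [eventually_isIdealHom (Function.update (0 : ∀ i, E i) i x)] with κ hκ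
  have h := hκ i
  rw [Function.update_self] at h
  exact h.map_smul c x (self_mem_principalIdeal x)

theorem eventually_map_nonneg [Fintype ι] (x : ∀ i, E i) :
    ∀ᶠ κ in idealHomFilter E, ∀ i, 0 ≤ x i → 0 ≤ κ i (x i) := by
  filter_upwards [eventually_isIdealHom x] with κ hκ i hi
  exact (hκ i).nonneg (self_mem_principalIdeal _) hi

theorem prod_apply_update [Fintype ι] [DecidableEq ι] (κ : ∀ i, E i → ℝ) (x : ∀ i, E i) (i : ι)
    (v : E i) : ∏ j, κ j (Function.update x i v j) =
      κ i v * ∏ j ∈ Finset.univ.erase i, κ j (x j) := by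
  rw [← Finset.mul_prod_erase _ _ (Finset.mem_univ i), Function.update_self]
  congr 1
  refine Finset.prod_congr rfl fun j hj => ?_
  rw [Function.update_of_ne (Finset.ne_of_mem_erase hj)]

variable (E) in
/-- The germ of the product map `x ↦ (κ ↦ ∏ i, κ i (x i))`. -/
noncomputable def germProd [Fintype ι] :
    MultilinearMap ℝ E (Germ (idealHomFilter E) ℝ) where
  toFun x := ((fun κ => ∏ i, κ i (x i) : (∀ i, E i → ℝ) → ℝ) : Germ (idealHomFilter E) ℝ)
  map_update_add' x i y z := by
    refine Germ.coe_eq.mpr ?_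
    filter_upwards [eventually_map_add i y z] with κ hκ
    simp only [prod_apply_update, hκ, add_mul]
  map_update_smul' x i c y := by
    refine Germ.coe_eq.mpr ?_
    filter_upwards [eventually_map_smul i c y] with κ hκ
    simp only [prod_apply_update, hκ, mul_assoc, Function.comp_apply, smul_eq_mul]

theorem isRieszMultimorphism_germProd [Fintype ι] : IsRieszMultimorphism (germProd E) := by
  intro _ x i y z hx
  refine Germ.coe_eq.mpr ?_
  filter_upwards [eventually_map_sup i y z, eventually_map_nonneg x] with κ hκ hnn
  simp only [prod_apply_update, hκ]
  exact max_mul_of_nonneg _ _ (Finset.prod_nonneg fun j hj =>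
    hnn j (hx j (Finset.ne_of_mem_erase hj)))

/-- Germs along a general filter need not be Archimedean. Here the countably many conditions `n f ≤
g` hold simultaneously on one set of the filter, and the reals are Archimedean. -/
theorem isArchimedeanLattice_germ [∀ i, HasSolidNorm (E i)] [∀ i, CompleteSpace (E i)] :
    IsArchimedeanLattice (Germ (idealHomFilter E) ℝ) := by
  intro a b
  refine Germ.inductionOn₂ a b fun f g h => ?_
  have h1 : ∀ n : ℕ, ∀ᶠ κ in idealHomFilter E, (n : ℝ) * f κ ≤ g κ := fun n => by
    have h2 : ((n • f : (∀ i, E i → ℝ) → ℝ) : Germ (idealHomFilter E) ℝ) ≤ g := h n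
    filter_upwards [Germ.coe_le.mp h2] with κ hκ
    simpa using hκ
  refine Germ.coe_le.mpr ?_
  filter_upwards [eventually_forall_idealHomFilter h1] with κ hκ
  by_contra! hlt
  obtain ⟨n, hn⟩ := exists_nat_gt (g κ / f κ)
  have hlt : 0 < f κ := hlt
  rw [div_lt_iff₀ hlt] at hn
  exact absurd (hκ n) hn.not_ge

instance : IsOrderedModule ℝ (Germ (idealHomFilter E) ℝ) where
  smul_le_smul_of_nonneg_left c hc a b h := by
    revert h
    refine Germ.inductionOn₂ a b fun f g h => Germ.coe_le.mpr ?_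
    filter_upwards [Germ.coe_le.mp h] with κ hκ
    exact mul_le_mul_of_nonneg_left hκ hc
  smul_le_smul_of_nonneg_right a ha c d h := by
    revert ha
    refine Germ.inductionOn a fun f hf => Germ.coe_le.mpr ?_
    filter_upwards [Germ.coe_le.mp hf] with κ hκ
    exact mul_le_mul_of_nonneg_right h hκ

variable (E) in
/-- The Riesz multimorphism `germProd` as a model. -/
noncomputable def germModel [Fintype ι] [∀ i, HasSolidNorm (E i)] [∀ i, CompleteSpace (E i)] :
    RieszModel E where
  carrier := Germ (idealHomFilter E) ℝ
  archimedean := isArchimedeanLattice_germ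
  map := germProd E
  isRieszMultimorphism := isRieszMultimorphism_germProd

/-! ### The norm of elementary tensors -/

variable [Fintype ι] [∀ i, HasSolidNorm (E i)]

/-- The lift of `germProd` is a lattice homomorphism, hence monotone. -/
theorem eventually_prod_le_of_tmul_le [∀ i, CompleteSpace (E i)] {x : ∀ i, E i} {m : ℕ} {y : Fin m → ∀ i, E i}
    (h : RieszTensor.tmul x ≤ ∑ k, RieszTensor.tmul (y k)) :
    ∀ᶠ κ in idealHomFilter E, ∏ i, κ i (x i) ≤ ∑ k, ∏ i, κ i (y k i) := by
  obtain ⟨T, ⟨hsup, hT⟩, -⟩ := RieszTensor.existsUnique_lift (germModel E)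
  have h1 : T (RieszTensor.tmul x) ≤ T (∑ k, RieszTensor.tmul (y k)) := by
    exact sup_eq_right.mp ((hsup _ _).symm.trans (congrArg T (sup_eq_right.mpr h)))
  rw [map_sum, hT] at h1
  simp only [hT] at h1
  have h2 : ∑ k, (germModel E).map (y k) =
      ((∑ k, fun κ => ∏ i, κ i (y k i) : (∀ i, E i → ℝ) → ℝ) : Germ (idealHomFilter E) ℝ) :=
    (map_sum (Germ.coeAddHom (idealHomFilter E) : ((∀ i, E i → ℝ) → ℝ) →+ _) _ _).symm
  rw [h2] at h1
  filter_upwards [Germ.coe_le.mp h1] with κ hκ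
  simpa using hκ

/-- Domination of elementary tensors of positive vectors implies domination of the products of
norms. -/
theorem prod_norm_le_of_tmul_le [∀ i, CompleteSpace (E i)] {x : ∀ i, E i} (hx : ∀ i, 0 ≤ x i) {m : ℕ}
    {y : Fin m → ∀ i, E i} (hy : ∀ k i, 0 ≤ y k i)
    (h : RieszTensor.tmul x ≤ ∑ k, RieszTensor.tmul (y k)) :
    ∏ i, ‖x i‖ ≤ ∑ k, ∏ i, ‖y k i‖ := by
  classical
  obtain ⟨z₀, hz₀⟩ := eventually_idealHomFilter.mp (eventually_prod_le_of_tmul_le h)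
  -- Large enough that its ideal contains all vectors involved and that homomorphisms on it restrict
  -- to the ideal of `z₀ i`.
  let z : ∀ i, E i := fun i => |z₀ i| + x i + ∑ k, y k i
  have hz : ∀ i (v : E i), |v| ≤ z i → v ∈ principalIdeal (z i) := fun i v hv =>
    mem_principalIdeal_of_abs_le (self_mem_principalIdeal _) (hv.trans (le_abs_self _))
  have hsum : ∀ i, 0 ≤ ∑ k, y k i := fun i => Finset.sum_nonneg fun k _ => hy k i
  have hz₀z : ∀ i, z₀ i ∈ principalIdeal (z i) := fun i => hz i _ <| by
    exact (le_add_of_nonneg_right (add_nonneg (hx i) (hsum i))).trans_eq (add_assoc _ _ _).symm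
  have hxz : ∀ i, x i ∈ principalIdeal (z i) := fun i => hz i _ <| by
    rw [abs_of_nonneg (hx i)]
    exact (le_add_of_nonneg_left (abs_nonneg _)).trans (le_add_of_nonneg_right (hsum i))
  have hyz : ∀ k i, y k i ∈ principalIdeal (z i) := fun k i => hz i _ <| by
    rw [abs_of_nonneg (hy k i)]
    exact (Finset.single_le_sum (fun l _ => hy l i) (Finset.mem_univ k)).trans
      (le_add_of_nonneg_left (add_nonneg (abs_nonneg _) (hx i)))
  -- On the coordinates in `s` the homomorphisms have already been replaced by norms.
  have key : ∀ s : Finset ι, ∀ κ : ∀ i, E i → ℝ, (∀ i, IsIdealHom (z i) (κ i)) →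
      (∏ i ∈ s, ‖x i‖) * ∏ i ∈ sᶜ, κ i (x i) ≤
        ∑ k, (∏ i ∈ s, ‖y k i‖) * ∏ i ∈ sᶜ, κ i (y k i) := by
    intro s
    induction s using Finset.induction_on with
    | empty =>
      intro κ hκ
      simpa using hz₀ κ fun i => (hκ i).mono (hz₀z i)
    | insert i s hi ih =>
      intro κ hκ
      have hc : sᶜ = insert i (insert i s)ᶜ := by
        ext j
        by_cases hj : j = i <;> simp [hj, hi]
      have hi' : i ∉ (insert i s)ᶜ := by simp
      have hnn : ∀ v : ∀ i, E i, (∀ i, 0 ≤ v i) → (∀ i, v i ∈ principalIdeal (z i)) →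
          0 ≤ (∏ j ∈ s, ‖v j‖) * ∏ j ∈ (insert i s)ᶜ, κ j (v j) := fun v hv hvz =>
        mul_nonneg (Finset.prod_nonneg fun _ _ => norm_nonneg _)
          (Finset.prod_nonneg fun j _ => (hκ j).nonneg (hvz j) (hv j))
      set c := (∏ j ∈ s, ‖x j‖) * ∏ j ∈ (insert i s)ᶜ, κ j (x j) with hcdef
      set d : Fin m → ℝ := fun k => (∏ j ∈ s, ‖y k j‖) * ∏ j ∈ (insert i s)ᶜ, κ j (y k j)
        with hddef
      have hc0 : 0 ≤ c := hnn x hx hxz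
      have hd0 : ∀ k, 0 ≤ d k := fun k => hnn (y k) (hy k) (hyz k)
      -- The induction hypothesis holds with any homomorphism `τ` in coordinate `i`, so separation
      -- turns it into a vector inequality, to which the norm can be applied.
      have hle : c • x i ≤ ∑ k, d k • y k i := by
        refine le_of_forall_isIdealHom (Submodule.smul_mem _ _ (hxz i))
          (Submodule.sum_mem _ fun k _ => Submodule.smul_mem _ _ (hyz k i)) fun τ hτ => ?_
        have h1 := ih (Function.update κ i τ) fun j => by
          rcases eq_or_ne j i with rfl | hj
          · simpa using hτ
          · simpa [hj] using hκ j
        have hprod : ∀ v : ∀ i, E i, ∏ j ∈ sᶜ, Function.update κ i τ j (v j) =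
            τ (v i) * ∏ j ∈ (insert i s)ᶜ, κ j (v j) := by
          intro v
          rw [hc, Finset.prod_insert hi', Function.update_self]
          congr 1
          refine Finset.prod_congr rfl fun j hj => ?_
          rw [Function.update_of_ne (ne_of_mem_of_not_mem hj hi')]
        have hsumτ := hτ.map_sum (fun k => Submodule.smul_mem _ (d k) (hyz k i)) Finset.univ
        simp only [hτ.map_smul _ _ (hyz _ i)] at hsumτ
        rw [hτ.map_smul _ _ (hxz i), hsumτ]
        simp only [hprod] at h1
        calc c * τ (x i) = (∏ i ∈ s, ‖x i‖) * (τ (x i) * ∏ j ∈ (insert i s)ᶜ, κ j (x j)) := by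
              rw [hcdef]; ring
          _ ≤ _ := h1
          _ = _ := Finset.sum_congr rfl fun k _ => by rw [hddef]; ring
      have hnorm : c * ‖x i‖ ≤ ∑ k, d k * ‖y k i‖ := by
        have h1 : ‖c • x i‖ ≤ ‖∑ k, d k • y k i‖ := by
          refine norm_le_norm_of_abs_le_abs ?_
          rw [abs_of_nonneg (smul_nonneg hc0 (hx i))]
          exact hle.trans (le_abs_self _)
        rw [norm_smul, Real.norm_of_nonneg hc0] at h1
        refine h1.trans ((norm_sum_le _ _).trans_eq (Finset.sum_congr rfl fun k _ => ?_))
        rw [norm_smul, Real.norm_of_nonneg (hd0 k)]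
      simp only [Finset.prod_insert hi]
      calc _ = c * ‖x i‖ := by rw [hcdef]; ring
        _ ≤ _ := hnorm
        _ = _ := Finset.sum_congr rfl fun k _ => by rw [hddef]; ring
  -- With `s` everything, no homomorphism remains in the inequality, so the zero family will do.
  obtain ⟨κ, hκ⟩ : ∃ κ : ∀ i, E i → ℝ, ∀ i, IsIdealHom (z i) (κ i) :=
    ⟨fun _ _ => 0, fun _ => ⟨by simp, by simp, by simp⟩⟩
  simpa using key Finset.univ κ hκ

variable [Nonempty ι]

/-- The norm of an elementary tensor of positive vectors is at least the product of the norms. -/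
theorem prod_norm_le_norm_tmul [∀ i, CompleteSpace (E i)] {x : ∀ i, E i} (hx : ∀ i, 0 ≤ x i) :
    ∏ i, ‖x i‖ ≤ ‖RieszTensor.tmul x‖ := by
  refine le_csInf (RieszTensor.dominatingSums_nonempty _) ?_
  rintro _ ⟨m, y, hy, hle, rfl⟩
  exact prod_norm_le_of_tmul_le hx hy ((le_abs_self _).trans hle)

/-- Induction over the coordinates of unknown sign, splitting each into positive and negative part.
-/
theorem abs_tmul_le (x : ∀ i, E i) :
    |(RieszTensor.tmul x : RieszTensor E)| ≤ RieszTensor.tmul fun i => |x i| := by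
  classical
  have key : ∀ s : Finset ι, ∀ x : ∀ i, E i, (∀ i ∉ s, 0 ≤ x i) →
      |(RieszTensor.tmul x : RieszTensor E)| ≤ RieszTensor.tmul fun i => |x i| := by
    intro s
    induction s using Finset.induction_on with
    | empty =>
      intro x hx
      have hx' : ∀ i, 0 ≤ x i := fun i => hx i (Finset.notMem_empty i)
      rw [abs_of_nonneg (RieszTensor.tmul_nonneg hx')]
      simp only [abs_of_nonneg (hx' _), le_refl]
    | insert i s hi ih =>
      intro x hx
      have hpos : ∀ v : E i, 0 ≤ v → ∀ j ∉ s, 0 ≤ Function.update x i v j := by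
        intro v hv j hj
        rcases eq_or_ne j i with rfl | hji
        · simpa using hv
        · rw [Function.update_of_ne hji]
          exact hx j (by simp [hji, hj])
      have habs : ∀ v : E i, 0 ≤ v → (fun j => |Function.update x i v j|) =
          Function.update (fun j => |x j|) i v := by
        intro v hv
        funext j
        rcases eq_or_ne j i with rfl | hji
        · simp [abs_of_nonneg hv]
        · simp [hji]
      have h1 := ih _ (hpos _ (posPart_nonneg (x i)))
      have h2 := ih _ (hpos _ (negPart_nonneg (x i)))
      rw [habs _ (posPart_nonneg _)] at h1
      rw [habs _ (negPart_nonneg _)] at h2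
      have h3 : (RieszTensor.tmul x : RieszTensor E) =
          RieszTensor.tmul (Function.update x i (x i)⁺) -
            RieszTensor.tmul (Function.update x i (x i)⁻) := by
        rw [← MultilinearMap.map_update_sub, posPart_sub_negPart, Function.update_eq_self]
      have h4 : (RieszTensor.tmul (fun j => |x j|) : RieszTensor E) =
          RieszTensor.tmul (Function.update (fun j => |x j|) i (x i)⁺) +
            RieszTensor.tmul (Function.update (fun j => |x j|) i (x i)⁻) := by
        rw [← MultilinearMap.map_update_add, posPart_add_negPart]
        simp
      rw [h3, h4, sub_eq_add_neg]
      refine (abs_add_le _ _).trans ?_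
      rw [abs_neg]
      exact add_le_add h1 h2
  exact key Finset.univ x fun i hi => absurd (Finset.mem_univ i) hi

theorem norm_tmul_le (x : ∀ i, E i) :
    ‖(RieszTensor.tmul x : RieszTensor E)‖ ≤ ∏ i, ‖x i‖ := by
  refine csInf_le (RieszTensor.dominatingSums_bddBelow _)
    ⟨1, fun _ i => |x i|, fun _ i => abs_nonneg _, ?_, ?_⟩
  · simpa using abs_tmul_le x
  · simp [norm_abs_eq_norm]

end GermModel

/-! ### The weak Dunford-Pettis property in terms of functionals -/

section NullSequences

variable {E : Type u} [NormedAddCommGroup E] [NormedSpace ℝ E]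

open scoped ZeroAtInfty

/-- A weakly null sequence is bounded. -/
theorem WeaklyNull.exists_norm_le {x : ℕ → E} (hx : WeaklyNull x) : ∃ C, ∀ j, ‖x j‖ ≤ C := by
  obtain ⟨C, hC⟩ := banach_steinhaus (g := fun j => NormedSpace.inclusionInDoubleDual ℝ E (x j))
    (fun f => by
      obtain ⟨C, hC⟩ := (hx f).norm.bddAbove_range
      exact ⟨C, fun j => hC ⟨j, rfl⟩⟩)
  refine ⟨C, fun j => ?_⟩
  exact ((NormedSpace.inclusionInDoubleDualLi ℝ (E := E)).norm_map (x j)).symm.trans_le (hC j)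

/-- The element of `c₀` given by a real null sequence. -/
def nullSequence (a : ℕ → ℝ) (ha : Tendsto a atTop (𝓝 0)) : C₀(ULift.{u} ℕ, ℝ) where
  toFun j := a j.down
  continuous_toFun := continuous_of_discreteTopology
  zero_at_infty' := by
    rw [cocompact_eq_cofinite]
    have h : Tendsto (ULift.down : ULift.{u} ℕ → ℕ) cofinite cofinite :=
      ULift.down_injective.tendsto_cofinite
    rw [Nat.cofinite_eq_atTop] at h
    exact ha.comp h

/-- The bounded operator `x ↦ (f j x)` into `c₀` given by a pointwise null sequence of bounded
functionals. -/
noncomputable def nullSequenceOperator (f : ℕ → StrongDual ℝ E)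
    (hf : ∀ x, Tendsto (fun j => f j x) atTop (𝓝 0)) {C : ℝ} (hC : ∀ j, ‖f j‖ ≤ C) :
    E →L[ℝ] C₀(ULift.{u} ℕ, ℝ) :=
  LinearMap.mkContinuous
    { toFun := fun x => nullSequence (fun j => f j x) (hf x)
      map_add' := fun x y => by ext j; exact map_add (f j.down) x y
      map_smul' := fun c x => by ext j; exact map_smul (f j.down) c x }
    C (fun x => by
      have hC0 : 0 ≤ C := (norm_nonneg _).trans (hC 0)
      rw [← ZeroAtInftyContinuousMap.norm_toBCF_eq_norm]
      refine (BoundedContinuousFunction.norm_le (by positivity)).mpr fun j => ?_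
      exact (f j.down).le_of_opNorm_le (hC _) x)

/-- A functional on `c₀` is represented by a summable sequence. -/
theorem exists_hasSum_of_dual_zeroAtInfty (g : StrongDual ℝ C₀(ULift.{u} ℕ, ℝ)) :
    ∃ a : ℕ → ℝ, Summable (fun j => |a j|) ∧
      ∀ y : C₀(ULift.{u} ℕ, ℝ), HasSum (fun j => a j * y ⟨j⟩) (g y) := by
  classical
  have hsingle : ∀ i : ℕ, Tendsto (fun j => if j = i then (1 : ℝ) else 0) atTop (𝓝 0) := by
    intro i
    refine tendsto_const_nhds.congr' ?_
    filter_upwards [eventually_gt_atTop i] with j hj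
    rw [if_neg hj.ne']
  let e : ℕ → C₀(ULift.{u} ℕ, ℝ) := fun i => nullSequence _ (hsingle i)
  have he : ∀ (s : Finset ℕ) (b : ℕ → ℝ) (j : ULift.{u} ℕ),
      (∑ i ∈ s, b i • e i : C₀(ULift.{u} ℕ, ℝ)) j = if j.down ∈ s then b j.down else 0 := by
    intro s b j
    have h1 : (∑ i ∈ s, b i • e i : C₀(ULift.{u} ℕ, ℝ)) j = ∑ i ∈ s, (b i • e i) j := by
      induction s using Finset.induction_on with
      | empty => simp
      | insert i s hi ih => rw [Finset.sum_insert hi, Finset.sum_insert hi, ← ih]; rfl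
    rw [h1]
    have h2 : ∀ i, (b i • e i) j = if j.down = i then b i else 0 := by
      intro i
      change b i * (if j.down = i then (1 : ℝ) else 0) = _
      rw [mul_ite, mul_one, mul_zero]
    simp only [h2]
    exact Finset.sum_ite_eq s j.down b
  have hsum : Summable fun j => |g (e j)| := by
    refine summable_of_sum_le (c := ‖g‖) (fun _ => abs_nonneg _) fun s => ?_
    -- Testing `g` on a combination of unit vectors with signs as coefficients, of norm at most one.
    have h1 : ∑ i ∈ s, |g (e i)| = g (∑ i ∈ s, (SignType.sign (g (e i)) : ℝ) • e i) := by
      rw [map_sum]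
      refine Finset.sum_congr rfl fun i _ => ?_
      rw [map_smul, smul_eq_mul, sign_mul_self]
    rw [h1]
    refine (le_abs_self _).trans ((g.le_opNorm _).trans ?_)
    refine mul_le_of_le_one_right (norm_nonneg _) ?_
    rw [← ZeroAtInftyContinuousMap.norm_toBCF_eq_norm]
    refine (BoundedContinuousFunction.norm_le zero_le_one).mpr fun j => ?_
    change ‖(∑ i ∈ s, (SignType.sign (g (e i)) : ℝ) • e i : C₀(ULift.{u} ℕ, ℝ)) j‖ ≤ 1
    rw [he]
    split_ifs
    · rcases lt_trichotomy (g (e j.down)) 0 with h | h | h <;> simp [h]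
    · simp
  refine ⟨fun j => g (e j), hsum, fun y => ?_⟩
  have hy : HasSum (fun j => y ⟨j⟩ • e j) y := by
    rw [HasSum, SummationFilter.unconditional_filter, Metric.tendsto_atTop]
    intro ε hε
    have hy0 : Tendsto (fun j : ULift.{u} ℕ => y j) cofinite (𝓝 0) := by
      rw [← cocompact_eq_cofinite]
      exact y.zero_at_infty'
    have hfin : {j : ULift.{u} ℕ | ¬ |y j| < ε / 2}.Finite := by
      have := hy0.eventually (Metric.ball_mem_nhds (0 : ℝ) (half_pos hε))
      simpa [Metric.mem_ball, Filter.eventually_cofinite] using this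
    refine ⟨hfin.toFinset.image ULift.down, fun s hs => ?_⟩
    rw [dist_eq_norm]
    refine lt_of_le_of_lt ?_ (half_lt_self hε)
    rw [← ZeroAtInftyContinuousMap.norm_toBCF_eq_norm]
    refine (BoundedContinuousFunction.norm_le (half_pos hε).le).mpr fun j => ?_
    change ‖(∑ i ∈ s, y ⟨i⟩ • e i : C₀(ULift.{u} ℕ, ℝ)) j - y j‖ ≤ ε / 2
    rw [he s (fun i => y ⟨i⟩)]
    split_ifs with hj
    · simpa using (half_pos hε).le
    · rw [zero_sub, norm_neg, Real.norm_eq_abs]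
      by_contra! hlt
      refine hj (hs ?_)
      rw [Finset.mem_image]
      exact ⟨j, by simpa using hlt.le, rfl⟩
  have h := hy.mapL g
  simpa only [map_smul, smul_eq_mul, mul_comm] using h

/-- Along a weakly null sequence of functionals, evaluation defines a weakly compact operator into
`c₀`. -/
theorem isWeaklyCompactOperator_nullSequenceOperator {f : ℕ → StrongDual ℝ E}
    (hwf : WeaklyNull f) (hf : ∀ x, Tendsto (fun j => f j x) atTop (𝓝 0)) {C : ℝ}
    (hC : ∀ j, ‖f j‖ ≤ C) : IsWeaklyCompactOperator (nullSequenceOperator f hf hC) := by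
  -- The extension of the operator to the bidual. It takes values in `c₀` because `f` is weakly
  -- null.
  let R : WeakDual ℝ (StrongDual ℝ E) → WeakSpace ℝ C₀(ULift.{u} ℕ, ℝ) := fun ψ =>
    toWeakSpace ℝ _ (nullSequence (fun j => ψ (f j)) (hwf (WeakDual.toStrongDual ψ)))
  have hR : Continuous R := by
    refine WeakBilin.continuous_of_continuous_eval _ fun g => ?_
    obtain ⟨a, ha, hg⟩ := exists_hasSum_of_dual_zeroAtInfty g
    have hs : Summable fun j => a j • f j := by
      refine Summable.of_norm_bounded (ha.mul_right C) fun j => ?_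
      rw [norm_smul]
      exact mul_le_mul_of_nonneg_left (hC j) (norm_nonneg _)
    -- Functionals on `c₀` pull back along `R` to evaluations at elements of the dual, so `R` is
    -- weak*-to-weak continuous and maps the bidual ball to a compact set.
    have h : ∀ ψ : WeakDual ℝ (StrongDual ℝ E),
        g (nullSequence (fun j => ψ (f j)) (hwf (WeakDual.toStrongDual ψ))) =
          ψ (∑' j, a j • f j) := by
      intro ψ
      have h1 := (hs.hasSum).mapL (WeakDual.toStrongDual ψ)
      simp only [map_smul, smul_eq_mul] at h1
      exact (hg _).unique h1
    exact (WeakDual.eval_continuous (∑' j, a j • f j)).congr fun ψ => (h ψ).symm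
  have hK : IsCompact (R '' (WeakDual.toStrongDual ⁻¹' Metric.closedBall 0 1)) :=
    (WeakDual.isCompact_closedBall 0 1).image hR
  refine hK.of_isClosed_subset isClosed_closure ?_
  have : T2Space (WeakSpace ℝ C₀(ULift.{u} ℕ, ℝ)) := inferInstance
  refine closure_minimal ?_ hK.isClosed
  rintro _ ⟨_, ⟨x, hx, rfl⟩, rfl⟩
  refine ⟨StrongDual.toWeakDual (NormedSpace.inclusionInDoubleDual ℝ E x), ?_, rfl⟩
  rw [mem_closedBall_zero_iff] at hx
  refine (mem_closedBall_zero_iff (E := StrongDual ℝ (StrongDual ℝ E))).mpr ?_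
  exact (NormedSpace.double_dual_bound ℝ E x).trans hx

/-- `f j (x j)` is the `j`-th coordinate of the image of `x j` in `c₀`. The lifted index set puts
`c₀` in the universe of `E`, as `WeakDunfordPettis` requires. -/
theorem WeakDunfordPettis.tendsto_apply [Lattice E] (hE : WeakDunfordPettis E) {x : ℕ → E}
    (hx : WeaklyNull x) (hdisj : ∀ j k, j ≠ k → |x j| ⊓ |x k| = 0) {f : ℕ → StrongDual ℝ E}
    (hf : WeaklyNull f) : Tendsto (fun j => f j (x j)) atTop (𝓝 0) := by
  obtain ⟨C, hC⟩ := hf.exists_norm_le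
  have hf0 : ∀ y, Tendsto (fun j => f j y) atTop (𝓝 0) := fun y =>
    hf (NormedSpace.inclusionInDoubleDual ℝ E y)
  have h := hE _ _ (isWeaklyCompactOperator_nullSequenceOperator hf hf0 hC) x hx hdisj
  refine squeeze_zero_norm (fun j => ?_) h
  have h1 := (nullSequenceOperator f hf0 hC (x j)).toBCF.norm_coe_le_norm ⟨j⟩
  rwa [ZeroAtInftyContinuousMap.norm_toBCF_eq_norm] at h1

end NullSequences

/-! ### Disjoint weakly null sequences -/

section DisjointSequences

set_option linter.unusedSectionVars false

variable {E : Type*} [NormedAddCommGroup E] [NormedSpace ℝ E] [Lattice E]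
  [IsOrderedAddMonoid E] [IsOrderedModule ℝ E] [HasSolidNorm E]

theorem norm_le_norm_of_nonneg_of_le {x y : E} (hx : 0 ≤ x) (h : x ≤ y) : ‖x‖ ≤ ‖y‖ :=
  norm_le_norm_of_abs_le_abs <| by rwa [abs_of_nonneg hx, abs_of_nonneg (hx.trans h)]

theorem exists_subseq_le_norm {x : ℕ → E} (h : ¬ NormNull x) :
    ∃ δ > 0, ∃ φ : ℕ → ℕ, StrictMono φ ∧ ∀ n, δ ≤ ‖x (φ n)‖ := by
  rw [NormNull, Metric.tendsto_atTop] at h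
  push Not at h
  obtain ⟨δ, hδ, h⟩ := h
  obtain ⟨φ, hφ, h⟩ := extraction_of_frequently_atTop (P := fun n => δ ≤ ‖x n‖)
    (frequently_atTop.mpr fun N => by
      obtain ⟨n, hn, h⟩ := h N
      exact ⟨n, hn, by simpa using h⟩)
  exact ⟨δ, hδ, φ, hφ, h⟩

theorem WeaklyNull.comp_strictMono {x : ℕ → E} (hx : WeaklyNull x) {φ : ℕ → ℕ}
    (hφ : StrictMono φ) : WeaklyNull fun n => x (φ n) :=
  fun f => (hx f).comp hφ.tendsto_atTop

/-- A positive sequence dominated by a weakly null sequence is weakly null. -/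
theorem WeaklyNull.of_nonneg_of_le {x v : ℕ → E} (hx : WeaklyNull x) (hv : ∀ n, 0 ≤ v n)
    (hvx : ∀ n, v n ≤ x n) : WeaklyNull v := by
  have key : ∀ (f : StrongDual ℝ E) (ε : ℝ), 0 < ε → ∀ᶠ n in atTop, f (v n) < ε := by
    intro f ε hε
    by_contra hcon
    rw [not_eventually] at hcon
    obtain ⟨φ, hφ, h⟩ := extraction_of_frequently_atTop hcon
    simp only [not_lt] at h
    -- Mazur's theorem: convex combinations of the `x (φ n)` come arbitrarily close to zero in norm.
    have h0 : (0 : E) ∈ closure (convexHull ℝ (Set.range fun n => x (φ n))) := by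
      by_contra h0
      obtain ⟨g, c, hgc, hg⟩ := geometric_hahn_banach_point_closed
        (convex_convexHull ℝ _).closure isClosed_closure h0
      rw [map_zero] at hgc
      have h1 : ∀ n, c ≤ g (x (φ n)) := fun n =>
        (hg _ (subset_closure (subset_convexHull ℝ _ ⟨n, rfl⟩))).le
      exact absurd (ge_of_tendsto (hx.comp_strictMono hφ g) (Eventually.of_forall h1)) hgc.not_ge
    -- The same combination of the `v (φ n)` lies below and keeps `f` at least `ε`; a small norm
    -- contradicts this.
    have hD : convexHull ℝ (Set.range fun n => x (φ n)) ⊆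
        {c | ∃ w, 0 ≤ w ∧ w ≤ c ∧ ε ≤ f w} := by
      refine convexHull_min ?_ ?_
      · rintro _ ⟨n, rfl⟩
        exact ⟨v (φ n), hv _, hvx _, h n⟩
      · rintro a ⟨w, hw, hwa, hfw⟩ b ⟨w', hw', hwb, hfw'⟩ s t hs ht hst
        refine ⟨s • w + t • w', add_nonneg (smul_nonneg hs hw) (smul_nonneg ht hw'),
          add_le_add (smul_le_smul_of_nonneg_left hwa hs) (smul_le_smul_of_nonneg_left hwb ht), ?_⟩
        rw [map_add, map_smul, map_smul, smul_eq_mul, smul_eq_mul]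
        calc ε = s * ε + t * ε := by rw [← add_mul, hst, one_mul]
          _ ≤ _ := add_le_add (mul_le_mul_of_nonneg_left hfw hs)
            (mul_le_mul_of_nonneg_left hfw' ht)
    obtain ⟨c, hc, hc0⟩ := Metric.mem_closure_iff.mp h0 (ε / (‖f‖ + 1)) (by positivity)
    rw [dist_zero_left, lt_div_iff₀ (by positivity)] at hc0
    obtain ⟨w, hw, hwc, hfw⟩ := hD hc
    have h1 : f w ≤ ‖f‖ * ‖c‖ := (le_abs_self _).trans ((f.le_opNorm w).trans
      (mul_le_mul_of_nonneg_left (norm_le_norm_of_nonneg_of_le hw hwc) (norm_nonneg f)))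
    nlinarith [norm_nonneg c]
  intro f
  rw [Metric.tendsto_atTop']
  intro ε hε
  have h := (key f ε hε).and (key (-f) ε hε)
  obtain ⟨N, hN⟩ := eventually_atTop.mp h
  refine ⟨N, fun n hn => ?_⟩
  obtain ⟨h1, h2⟩ := hN n hn.le
  rw [dist_zero_right, Real.norm_eq_abs, abs_lt]
  exact ⟨by simpa [neg_lt] using h2, h1⟩

/-! ### Disjoint sequences and order intervals -/

theorem mem_principalIdeal_of_mem_Icc {u x : E} (h0 : 0 ≤ x) (h : x ≤ u) :
    x ∈ principalIdeal u := by
  refine mem_principalIdeal_of_abs_le (self_mem_principalIdeal u) ?_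
  rwa [abs_of_nonneg h0, abs_of_nonneg (h0.trans h)]

/-- Finite sums of disjoint vectors in an order interval stay in the interval. -/
theorem sum_le_of_disjoint {v : ℕ → E} {u : E} (hu : 0 ≤ u) (hv : ∀ n, 0 ≤ v n)
    (hvu : ∀ n, v n ≤ u) (hdisj : ∀ j k, j ≠ k → v j ⊓ v k = 0) (s : Finset ℕ) :
    ∑ n ∈ s, v n ≤ u := by
  have hmem : ∀ n, v n ∈ principalIdeal u := fun n => mem_principalIdeal_of_mem_Icc (hv n) (hvu n)
  refine le_of_forall_isIdealHom (Submodule.sum_mem _ fun n _ => hmem n)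
    (self_mem_principalIdeal u) fun κ hκ => ?_
  rw [hκ.map_sum hmem]
  have hu0 : 0 ≤ κ u := hκ.nonneg (self_mem_principalIdeal u) hu
  -- A real lattice homomorphism is nonzero on at most one of several disjoint vectors.
  by_cases h : ∃ k ∈ s, κ (v k) ≠ 0
  · obtain ⟨k, hk, hne⟩ := h
    rw [Finset.sum_eq_single_of_mem k hk]
    · exact hκ.le_of_le (hmem k) (self_mem_principalIdeal u) (hvu k)
    · intro j _ hjk
      have h1 : v j ⊔ v k = v j + v k := by
        rw [← inf_add_sup (v j) (v k), hdisj j k hjk, zero_add]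
      have h2 := hκ.map_sup _ (hmem j) _ (hmem k)
      rw [h1, hκ.map_add _ (hmem j) _ (hmem k)] at h2
      have h3 := hκ.nonneg (hmem j) (hv j)
      have h4 : 0 < κ (v k) := (hκ.nonneg (hmem k) (hv k)).lt_of_ne' hne
      rcases max_choice (κ (v j)) (κ (v k)) with h5 | h5 <;> rw [h5] at h2 <;> linarith
  · push Not at h
    rwa [Finset.sum_eq_zero h]

/-- Disjoint order bounded sequences are weakly null. -/
theorem weaklyNull_of_disjoint_of_le {v : ℕ → E} {u : E} (hu : 0 ≤ u) (hv : ∀ n, 0 ≤ v n)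
    (hvu : ∀ n, v n ≤ u) (hdisj : ∀ j k, j ≠ k → v j ⊓ v k = 0) : WeaklyNull v := by
  intro f
  have hbound : ∀ s : Finset ℕ, |∑ n ∈ s, f (v n)| ≤ ‖f‖ * ‖u‖ := by
    intro s
    rw [← map_sum]
    exact (f.le_opNorm _).trans (mul_le_mul_of_nonneg_left
      (norm_le_norm_of_nonneg_of_le (Finset.sum_nonneg fun n _ => hv n)
        (sum_le_of_disjoint hu hv hvu hdisj s)) (norm_nonneg f))
  have hs : Summable fun n => |f (v n)| := by
    refine summable_of_sum_le (c := ‖f‖ * ‖u‖ + ‖f‖ * ‖u‖) (fun _ => abs_nonneg _) fun s => ?_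
    -- Each sign class contributes at most `‖f‖ * ‖u‖`.
    rw [← Finset.sum_filter_add_sum_filter_not s (fun n => 0 ≤ f (v n))]
    refine add_le_add ?_ ?_
    · rw [Finset.sum_congr rfl fun n hn => abs_of_nonneg (Finset.mem_filter.mp hn).2]
      exact (le_abs_self _).trans (hbound _)
    · rw [Finset.sum_congr rfl fun n hn => abs_of_neg (not_le.mp (Finset.mem_filter.mp hn).2),
        Finset.sum_neg_distrib]
      exact (neg_le_abs _).trans (hbound _)
  exact (tendsto_zero_iff_abs_tendsto_zero _).mpr hs.tendsto_atTop_zero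

/-- A positive sequence bounded away from zero whose pairwise infima tend to zero is, up to small
perturbations of a subsequence, disjoint. -/
theorem exists_disjoint_of_tendsto_inf [CompleteSpace E] {y : ℕ → E} (hy : ∀ n, 0 ≤ y n) {δ : ℝ}
    (hδ : 0 < δ) (hyδ : ∀ n, δ ≤ ‖y n‖) (hinf : ∀ i, NormNull fun n => y i ⊓ y n) :
    ∃ (φ : ℕ → ℕ) (v : ℕ → E), StrictMono φ ∧ (∀ n, 0 ≤ v n) ∧ (∀ n, v n ≤ y (φ n)) ∧
      (∀ n, δ / 2 ≤ ‖v n‖) ∧ ∀ j k, j ≠ k → v j ⊓ v k = 0 := by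
  -- The second component is a strictly increasing counter, so it is at least the position in the
  -- sequence and controls the smallness.
  obtain ⟨f, -, hf⟩ := exists_seq_of_forall_finset_exists (α := ℕ × ℕ) (fun _ => True)
    (fun p q => p.1 < q.1 ∧ p.2 < q.2 ∧ ‖y p.1 ⊓ y q.1‖ ≤ δ / 8 * (1 / 4) ^ q.2) (by
      intro s _
      let c := s.sup Prod.snd + 1
      have h : ∀ᶠ n in atTop, ∀ p ∈ s, p.1 < n ∧ ‖y p.1 ⊓ y n‖ ≤ δ / 8 * (1 / 4) ^ c := by
        rw [Finset.eventually_all]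
        intro p _
        refine (eventually_gt_atTop p.1).and ?_
        exact (hinf p.1).eventually (Iic_mem_nhds (by positivity))
      obtain ⟨n, hn⟩ := h.exists
      exact ⟨(n, c), trivial, fun p hp => ⟨(hn p hp).1,
        Nat.lt_succ_of_le (Finset.le_sup (f := Prod.snd) hp), (hn p hp).2⟩⟩)
  have hφ : StrictMono fun n => (f n).1 := fun m n h => (hf m n h).1
  have hc : StrictMono fun n => (f n).2 := fun m n h => (hf m n h).2.1
  set φ : ℕ → ℕ := fun n => (f n).1 with hφdef
  have hsmall : ∀ i n, i < n → ‖y (φ i) ⊓ y (φ n)‖ ≤ δ / 8 * (1 / 4) ^ n := fun i n h =>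
    (hf i n h).2.2.trans (mul_le_mul_of_nonneg_left
      (pow_le_pow_of_le_one (by norm_num) (by norm_num) (hc.le_apply)) (by positivity))
  have hnn : ∀ i n, 0 ≤ y (φ i) ⊓ y (φ n) := fun i n => le_inf (hy _) (hy _)
  let w : ℕ → E := fun n => ∑ i ∈ Finset.range n, y (φ i) ⊓ y (φ n)
  have hw0 : ∀ n, 0 ≤ w n := fun n => Finset.sum_nonneg fun i _ => hnn i n
  have hwn : ∀ n, ‖w n‖ ≤ δ / 8 * (1 / 2) ^ n := by
    intro n
    calc ‖w n‖ ≤ ∑ i ∈ Finset.range n, δ / 8 * (1 / 4) ^ n :=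
          norm_sum_le_of_le _ fun i hi => hsmall i n (Finset.mem_range.mp hi)
      _ = δ / 8 * (n * (1 / 4) ^ n) := by
          rw [Finset.sum_const, Finset.card_range, nsmul_eq_mul]; ring
      _ ≤ δ / 8 * (2 ^ n * (1 / 4) ^ n) := by
          have : (n : ℝ) ≤ 2 ^ n := by exact_mod_cast Nat.lt_two_pow_self.le
          gcongr
      _ = δ / 8 * (1 / 2) ^ n := by rw [← mul_pow]; norm_num
  have hgeo : HasSum (fun n : ℕ => δ / 8 * (1 / 2 : ℝ) ^ n) (δ / 8 * 2) :=
    hasSum_geometric_two.mul_left _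
  have hws : Summable w := Summable.of_norm_bounded hgeo.summable hwn
  have hwnorm : ‖∑' n, w n‖ ≤ δ / 4 :=
    (tsum_of_norm_bounded hgeo hwn).trans (by linarith)
  have hle : ∀ i n, i < n → y (φ i) ⊓ y (φ n) ≤ ∑' n, w n := fun i n h =>
    (Finset.single_le_sum (f := fun i => y (φ i) ⊓ y (φ n)) (fun j _ => hnn j n)
      (Finset.mem_range.mpr h)).trans (hws.le_tsum n fun m _ => hw0 m)
  have hW0 : 0 ≤ ∑' n, w n := tsum_nonneg hw0
  set W := ∑' n, w n with hW
  -- `W` dominates every pairwise infimum, so subtracting it makes the terms disjoint. As `‖W‖ ≤ δ /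
  -- 4`, norms stay above `δ / 2`.
  refine ⟨φ, fun n => (y (φ n) - W) ⊔ 0, hφ, fun n => le_sup_right,
    fun n => sup_le (sub_le_self _ hW0) (hy _), fun n => ?_, ?_⟩
  · have h1 : ‖y (φ n)‖ ≤ ‖(y (φ n) - W) ⊔ 0 + W‖ :=
      norm_le_norm_of_nonneg_of_le (hy _) (sub_le_iff_le_add.mp le_sup_left)
    linarith [hyδ (φ n), norm_add_le ((y (φ n) - W) ⊔ 0) W]
  · have key : ∀ j k, j < k → ((y (φ j) - W) ⊔ 0) ⊓ ((y (φ k) - W) ⊔ 0) = 0 := by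
      intro j k h
      refine le_antisymm ?_ (le_inf le_sup_right le_sup_right)
      have h1 : ∀ x : E, y (φ j) ⊓ y (φ k) ≤ x → (x - W) ⊔ 0 ≤ x - y (φ j) ⊓ y (φ k) := fun x hx =>
        sup_le (sub_le_sub_left (hle j k h) x) (sub_nonneg.mpr hx)
      refine (inf_le_inf (h1 _ inf_le_left) (h1 _ inf_le_right)).trans_eq ?_
      rw [← inf_sub, sub_self]
    intro j k h
    rcases h.lt_or_gt with h | h
    · exact key j k h
    · rw [inf_comm]
      exact key k j h

/-- A sequence in an order interval that is bounded away from zero and of which any `M + 1` terms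
have zero infimum yields a disjoint sequence bounded away from zero. -/
theorem exists_disjoint_of_finite_multiplicity [CompleteSpace E] {u : E} (M : ℕ) :
    ∀ (y : ℕ → E) (δ : ℝ), 0 < δ → (∀ n, 0 ≤ y n) → (∀ n, y n ≤ u) → (∀ n, δ ≤ ‖y n‖) →
      (∀ s : Finset ℕ, s.card = M + 1 → ∀ m, 0 ≤ m → (∀ k ∈ s, m ≤ y k) → m = 0) →
      ∃ (v : ℕ → E) (δ' : ℝ), 0 < δ' ∧ (∀ n, 0 ≤ v n) ∧ (∀ n, v n ≤ u) ∧ (∀ n, δ' ≤ ‖v n‖) ∧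
        ∀ j k, j ≠ k → v j ⊓ v k = 0 := by
  induction M with
  | zero =>
    intro y δ hδ hy _ hyδ h
    have h0 := h {0} rfl (y 0) (hy 0) (by simp)
    have := hyδ 0
    rw [h0, norm_zero] at this
    exact absurd this hδ.not_ge
  | succ M ih =>
    intro y δ hδ hy hyu hyδ h
    by_cases hinf : ∀ i, NormNull fun n => y i ⊓ y n
    · obtain ⟨φ, v, -, hv, hvy, hvδ, hdisj⟩ := exists_disjoint_of_tendsto_inf hy hδ hyδ hinf
      exact ⟨v, δ / 2, half_pos hδ, hv, fun n => (hvy n).trans (hyu _), hvδ, hdisj⟩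
    · push Not at hinf
      obtain ⟨i, hi⟩ := hinf
      obtain ⟨δ', hδ', φ, hφ, hφδ⟩ := exists_subseq_le_norm hi
      -- Infima with the fixed term `y i` have multiplicity one less. The shift keeps the other
      -- indices beyond `i`, so that `i` counts as an additional one.
      refine ih (fun n => y i ⊓ y (φ (n + (i + 1)))) δ' hδ' (fun n => le_inf (hy _) (hy _))
        (fun n => inf_le_left.trans (hyu i)) (fun n => hφδ _) fun s hs m hm hle => ?_
      have hinj : Function.Injective fun n => φ (n + (i + 1)) :=
        hφ.injective.comp (add_left_injective _)
      have hgt : ∀ n, i < φ (n + (i + 1)) := fun n =>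
        lt_of_lt_of_le (by omega) (hφ.le_apply (x := n + (i + 1)))
      have hne : s.Nonempty := Finset.card_pos.mp (by omega)
      refine h (insert i (s.image fun n => φ (n + (i + 1)))) ?_ m hm ?_
      · rw [Finset.card_insert_of_notMem, Finset.card_image_of_injective _ hinj, hs]
        intro hmem
        obtain ⟨n, -, hn⟩ := Finset.mem_image.mp hmem
        exact absurd hn (hgt n).ne'
      · intro k hk
        rcases Finset.mem_insert.mp hk with rfl | hk
        · obtain ⟨n, hn⟩ := hne
          exact (hle n hn).trans inf_le_left
        · obtain ⟨n, hn, rfl⟩ := Finset.mem_image.mp hk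
          exact (hle n hn).trans inf_le_right

/-- If an increasing sequence in an order interval is not norm Cauchy, then the interval contains a
disjoint sequence bounded away from zero. -/
theorem exists_disjoint_of_not_cauchySeq [CompleteSpace E] {u : E} {a : ℕ → E} (ha : Monotone a)
    (ha0 : ∀ n, 0 ≤ a n) (hau : ∀ n, a n ≤ u) (hC : ¬ CauchySeq a) :
    ∃ (v : ℕ → E) (δ : ℝ), 0 < δ ∧ (∀ n, 0 ≤ v n) ∧ (∀ n, v n ≤ u) ∧ (∀ n, δ ≤ ‖v n‖) ∧
      ∀ j k, j ≠ k → v j ⊓ v k = 0 := by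
  rw [Metric.cauchySeq_iff'] at hC
  push Not at hC
  obtain ⟨ε, hε, hC⟩ := hC
  choose g hg hgε using hC
  let N : ℕ → ℕ := fun k => g^[k] 0
  have hN : ∀ k, N (k + 1) = g (N k) := fun k => Function.iterate_succ_apply' g k 0
  let d : ℕ → E := fun k => a (N (k + 1)) - a (N k)
  have hd0 : ∀ k, 0 ≤ d k := fun k => sub_nonneg.mpr (ha (by rw [hN]; exact hg _))
  have hdε : ∀ k, ε ≤ ‖d k‖ := fun k => by
    have := hgε (N k)
    rwa [dist_eq_norm, ← hN] at this
  have hdsum : ∀ s : Finset ℕ, ∑ k ∈ s, d k ≤ u := by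
    intro s
    calc ∑ k ∈ s, d k ≤ ∑ k ∈ Finset.range (s.sup id + 1), d k :=
          Finset.sum_le_sum_of_subset_of_nonneg (fun k hk => Finset.mem_range.mpr
            (Nat.lt_succ_of_le (Finset.le_sup (f := id) hk))) fun k _ _ => hd0 k
      _ = a (N (s.sup id + 1)) - a (N 0) := Finset.sum_range_sub (fun k => a (N k)) _
      _ ≤ u := (sub_le_self _ (ha0 _)).trans (hau _)
  have hdu : ∀ k, d k ≤ u := fun k => by simpa using hdsum {k}
  have hu : 0 ≤ u := (ha0 0).trans (hau 0)
  -- Chosen so that cutting off `η • u` costs at most `ε / 2` in norm.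
  set η : ℝ := ε / (2 * (‖u‖ + 1)) with hη
  have hη0 : 0 < η := by positivity
  have hηu : ‖η • u‖ ≤ ε / 2 := by
    rw [norm_smul, Real.norm_of_nonneg hη0.le, hη, div_mul_eq_mul_div, div_le_iff₀ (by positivity)]
    nlinarith [norm_nonneg u]
  have hηu0 : 0 ≤ η • u := smul_nonneg hη0.le hu
  obtain ⟨M, hM⟩ := exists_nat_ge (1 / η)
  rw [div_le_iff₀ hη0] at hM
  have hdmem : ∀ k, d k ∈ principalIdeal u := fun k =>
    mem_principalIdeal_of_mem_Icc (hd0 k) (hdu k)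
  refine exists_disjoint_of_finite_multiplicity M (fun k => (d k - η • u) ⊔ 0) (ε / 2)
    (half_pos hε) (fun k => le_sup_right)
    (fun k => sup_le ((sub_le_self _ hηu0).trans (hdu k)) hu) (fun k => ?_) fun s hs m hm hle => ?_
  · have h1 : ‖d k‖ ≤ ‖(d k - η • u) ⊔ 0 + η • u‖ :=
      norm_le_norm_of_nonneg_of_le (hd0 k) (sub_le_iff_le_add.mp le_sup_left)
    linarith [hdε k, norm_add_le ((d k - η • u) ⊔ 0) (η • u)]
  · have hne : s.Nonempty := Finset.card_pos.mp (by omega)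
    have humem := self_mem_principalIdeal u
    have hηmem : η • u ∈ principalIdeal u := Submodule.smul_mem _ _ humem
    have hmu : m ≤ u := by
      obtain ⟨k, hk⟩ := hne
      exact (hle k hk).trans (sup_le ((sub_le_self _ hηu0).trans (hdu k)) hu)
    have hmmem := mem_principalIdeal_of_mem_Icc hm hmu
    refine le_antisymm ?_ hm
    refine le_of_forall_isIdealHom hmmem (zero_mem _) fun κ hκ => ?_
    rw [hκ.map_zero]
    by_contra! hpos
    have hu0 := hκ.nonneg humem hu
    -- Where `κ m > 0`, each of the `M + 1` increments exceeds `η * κ u`. Since `M * η ≥ 1`, their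
    -- sum would exceed `κ u`.
    have h1 : ∀ k ∈ s, κ m + η * κ u ≤ κ (d k) := by
      intro k hk
      have h2 := hκ.le_of_le hmmem (sup_mem_principalIdeal (sub_mem (hdmem k) hηmem) (zero_mem _))
        (hle k hk)
      have h4 := hκ.map_add _ (sub_mem (hdmem k) hηmem) _ hηmem
      rw [sub_add_cancel, hκ.map_smul _ _ humem] at h4
      rw [hκ.map_sup _ (sub_mem (hdmem k) hηmem) _ (zero_mem _), hκ.map_zero, le_max_iff] at h2
      rcases h2 with h2 | h2 <;> linarith
    have h2 := Finset.card_nsmul_le_sum s _ _ h1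
    rw [← hκ.map_sum hdmem, hs, nsmul_eq_mul] at h2
    have h3 := hκ.le_of_le (Submodule.sum_mem _ fun k _ => hdmem k) humem (hdsum s)
    push_cast at h2
    have h5 : κ u ≤ M * η * κ u := le_mul_of_one_le_left hu0 hM
    nlinarith [mul_nonneg hη0.le hu0, mul_nonneg (Nat.cast_nonneg (α := ℝ) M) hpos.le]

/-- Every positive vector is normed by a positive functional of norm at most one. -/
theorem exists_positive_dual_vector {z : E} (hz : 0 ≤ z) :
    ∃ f : StrongDual ℝ E, ‖f‖ ≤ 1 ∧ (∀ x, 0 ≤ x → 0 ≤ f x) ∧ f z = ‖z‖ := by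
  rcases eq_or_ne z 0 with rfl | hz0
  · exact ⟨0, by simp, by simp, by simp⟩
  -- Domination by `‖x⁺‖` instead of `‖x‖` forces the Hahn-Banach extension to be positive.
  obtain ⟨g, hg, hgN⟩ := exists_extension_of_le_sublinear
    (LinearPMap.mkSpanSingleton z ‖z‖ hz0) (fun x => ‖x⁺‖)
    (fun c hc x => by
      have h : (c • x)⁺ = c • x⁺ := by
        have h1 : c • (x ⊔ 0) = c • x ⊔ c • 0 := (OrderIso.smulRight hc).map_sup x 0
        rw [posPart_def, posPart_def, h1, smul_zero]
      rw [h, norm_smul, Real.norm_of_nonneg hc.le])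
    (fun x y => by
      refine (norm_le_norm_of_nonneg_of_le (posPart_nonneg _) ?_).trans (norm_add_le _ _)
      exact sup_le (add_le_add (le_posPart x) (le_posPart y))
        (add_nonneg (posPart_nonneg x) (posPart_nonneg y)))
    (by
      rintro ⟨x, hx⟩
      obtain ⟨c, rfl⟩ := Submodule.mem_span_singleton.mp hx
      rw [LinearPMap.mkSpanSingleton'_apply, RingHom.id_apply, smul_eq_mul]
      rcases le_total 0 c with hc | hc
      · rw [posPart_of_nonneg (smul_nonneg hc hz), norm_smul, Real.norm_of_nonneg hc]
      · exact (mul_nonpos_of_nonpos_of_nonneg hc (norm_nonneg z)).trans (norm_nonneg _))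
  have hle : ∀ x, g x ≤ ‖x‖ := fun x => (hgN x).trans <| by
    rw [← norm_abs_eq_norm x]
    exact norm_le_norm_of_nonneg_of_le (posPart_nonneg x)
      (sup_le (le_abs_self x) (abs_nonneg x))
  refine ⟨g.mkContinuous 1 fun x => ?_, LinearMap.mkContinuous_norm_le _ zero_le_one _, ?_, ?_⟩
  · rw [one_mul, Real.norm_eq_abs, abs_le]
    have := hle (-x)
    rw [map_neg, norm_neg] at this
    exact ⟨by linarith, hle x⟩
  · intro x hx
    have := hgN (-x)
    rw [map_neg, posPart_of_nonpos (neg_nonpos.mpr hx), norm_zero] at this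
    exact neg_nonpos.mp this
  · have := hg ⟨z, Submodule.mem_span_singleton_self z⟩
    rwa [LinearPMap.mkSpanSingleton_apply] at this

/-- A weakly null sequence in an order interval that is bounded away from zero yields a disjoint
sequence in the interval which is bounded away from zero. -/
theorem exists_disjoint_of_weaklyNull_of_le [CompleteSpace E] {u : E} {z : ℕ → E} {δ : ℝ}
    (hδ : 0 < δ) (hz : ∀ n, 0 ≤ z n) (hzu : ∀ n, z n ≤ u) (hzδ : ∀ n, δ ≤ ‖z n‖)
    (hzw : WeaklyNull z) :
    ∃ (v : ℕ → E) (δ' : ℝ), 0 < δ' ∧ (∀ n, 0 ≤ v n) ∧ (∀ n, v n ≤ u) ∧ (∀ n, δ' ≤ ‖v n‖) ∧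
      ∀ j k, j ≠ k → v j ⊓ v k = 0 := by
  by_contra hcon
  have hC : ∀ a : ℕ → E, Monotone a → (∀ n, 0 ≤ a n) → (∀ n, a n ≤ u) → CauchySeq a :=
    fun a ha ha0 hau => by_contra fun h => hcon (exists_disjoint_of_not_cauchySeq ha ha0 hau h)
  choose f hf1 hf0 hfz using fun n => exists_positive_dual_vector (hz n)
  have hfs : Summable fun n => (1 / 2 : ℝ) ^ n • f n := by
    refine Summable.of_norm_bounded summable_geometric_two fun n => ?_
    rw [norm_smul, Real.norm_of_nonneg (by positivity)]
    exact mul_le_of_le_one_right (by positivity) (hf1 n)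
  set F : StrongDual ℝ E := ∑' n, (1 / 2 : ℝ) ^ n • f n with hF
  -- `F` controls all the norming functionals: a positive vector killed by `F` is killed by every `f
  -- n`.
  have hFle : ∀ x, 0 ≤ x → ∀ n, (1 / 2 : ℝ) ^ n * f n x ≤ F x := by
    intro x hx n
    have h : HasSum (fun n => (1 / 2 : ℝ) ^ n * f n x) (F x) :=
      hfs.hasSum.mapL (ContinuousLinearMap.apply ℝ ℝ x)
    exact le_hasSum h n fun m _ => mul_nonneg (by positivity) (hf0 m x hx)
  have hF0 : ∀ x, 0 ≤ x → 0 ≤ F x := fun x hx =>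
    (mul_nonneg (by positivity) (hf0 0 x hx)).trans (hFle x hx 0)
  have hFmono : ∀ x y, x ≤ y → F x ≤ F y := fun x y h => by
    have := hF0 _ (sub_nonneg.mpr h)
    rw [map_sub] at this
    linarith
  obtain ⟨φ, hφ, hφF⟩ := extraction_forall_of_eventually (P := fun n k => F (z k) ≤ (1 / 2) ^ n)
    fun n => (hzw F).eventually (Iic_mem_nhds (by positivity : (0 : ℝ) < (1 / 2) ^ n))
  -- The finite suprema converge in norm to tail suprema `S i`, which decrease to a limit `u - t`.
  let s : ℕ → ℕ → E := fun i => partialSups fun k => z (φ (i + k))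
  have hsle : ∀ i k, z (φ (i + k)) ≤ s i k := fun i k =>
    le_partialSups (fun k => z (φ (i + k))) k
  have hs0 : ∀ i k, 0 ≤ s i k := fun i k => (hz _).trans (hsle i k)
  have hsu : ∀ i k, s i k ≤ u := fun i k => partialSups_le _ _ _ fun _ _ => hzu _
  have hsmono : ∀ i, Monotone (s i) := fun i => (partialSups _).monotone
  choose S hS using fun i => cauchySeq_tendsto_of_complete (hC (s i) (hsmono i) (hs0 i) (hsu i))
  have hsS : ∀ i k, s i k ≤ S i := fun i => (hsmono i).ge_of_tendsto (hS i)
  have hS0 : ∀ i, 0 ≤ S i := fun i => (hs0 i 0).trans (hsS i 0)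
  have hSu : ∀ i, S i ≤ u := fun i => le_of_tendsto' (hS i) (hsu i)
  have hSanti : Antitone S := antitone_nat_of_succ_le fun i =>
    le_of_tendsto' (hS (i + 1)) fun k => by
      refine partialSups_le _ _ _ fun j _ => ?_
      have : z (φ (i + 1 + j)) = z (φ (i + (j + 1))) := by rw [add_assoc, add_comm 1 j]
      rw [this]
      exact (hsle i (j + 1)).trans (hsS i _)
  obtain ⟨t, ht⟩ := cauchySeq_tendsto_of_complete (hC (fun i => u - S i)
    (fun i j h => sub_le_sub_left (hSanti h) u) (fun i => sub_nonneg.mpr (hSu i))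
    (fun i => sub_le_self _ (hS0 i)))
  have hSt : Tendsto S atTop (𝓝 (u - t)) := by
    have h : Tendsto (fun i => u - (u - S i)) atTop (𝓝 (u - t)) := tendsto_const_nhds.sub ht
    simpa using h
  have hFS : ∀ i, F (S i) ≤ (1 / 2) ^ i * 2 := by
    intro i
    refine le_of_tendsto' ((F.continuous.tendsto _).comp (hS i)) fun k => ?_
    have h1 : s i k ≤ ∑ j ∈ Finset.range (k + 1), z (φ (i + j)) :=
      partialSups_le _ _ _ fun j hj => Finset.single_le_sum (f := fun j => z (φ (i + j)))
        (fun _ _ => hz _) (Finset.mem_range.mpr (Nat.lt_succ_of_le hj))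
    refine (hFmono _ _ h1).trans ?_
    rw [map_sum]
    calc ∑ j ∈ Finset.range (k + 1), F (z (φ (i + j)))
        ≤ ∑ j ∈ Finset.range (k + 1), (1 / 2 : ℝ) ^ i * (1 / 2) ^ j :=
          Finset.sum_le_sum fun j _ => (hφF _).trans_eq (pow_add _ _ _)
      _ ≤ (1 / 2) ^ i * 2 := by
          rw [← Finset.mul_sum]
          exact mul_le_mul_of_nonneg_left (sum_geometric_two_le _) (by positivity)
  have hlim0 : 0 ≤ u - t := ge_of_tendsto' hSt hS0
  have hFlim : F (u - t) = 0 := by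
    refine le_antisymm ?_ (hF0 _ hlim0)
    refine le_of_tendsto_of_tendsto' ((F.continuous.tendsto _).comp hSt) ?_ hFS
    simpa using (tendsto_pow_atTop_nhds_zero_of_lt_one (r := (1 / 2 : ℝ)) (by norm_num)
      (by norm_num)).mul_const 2
  have hflim : ∀ n, f n (u - t) = 0 := by
    intro n
    have h := hFle _ hlim0 n
    rw [hFlim] at h
    exact le_antisymm (nonpos_of_mul_nonpos_right h (by positivity)) (hf0 n _ hlim0)
  -- `f (φ i)` vanishes at the limit but is at least `‖z (φ i)‖` at `S i`, so `S` stays away from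
  -- its limit.
  have hfinal : ∀ i, δ ≤ ‖S i - (u - t)‖ := by
    intro i
    have h1 : z (φ i) ≤ S i := (hsle i 0).trans (hsS i 0)
    have h2 := hf0 (φ i) _ (sub_nonneg.mpr h1)
    rw [map_sub, hfz] at h2
    have h3 : f (φ i) (S i - (u - t)) ≤ 1 * ‖S i - (u - t)‖ :=
      (le_abs_self _).trans ((f (φ i)).le_of_opNorm_le (hf1 _) _)
    rw [map_sub, hflim] at h3
    linarith [hzδ (φ i)]
  have h0 := (hSt.sub_const (u - t)).norm
  rw [sub_self, norm_zero] at h0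
  exact absurd (ge_of_tendsto' h0 hfinal) hδ.not_ge

end DisjointSequences

/-- A Banach lattice without the positive Schur property contains a positive disjoint weakly null
sequence which is bounded away from zero. -/
theorem exists_disjoint_weaklyNull_of_not_positiveSchur {E : Type u} [NormedAddCommGroup E]
    [NormedSpace ℝ E] [CompleteSpace E] [Lattice E] [IsOrderedAddMonoid E] [IsOrderedModule ℝ E]
    [HasSolidNorm E] (h : ¬ PositiveSchur E) :
    ∃ (v : ℕ → E) (δ : ℝ), 0 < δ ∧ (∀ n, 0 ≤ v n) ∧ WeaklyNull v ∧ (∀ n, δ ≤ ‖v n‖) ∧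
      ∀ j k, j ≠ k → v j ⊓ v k = 0 := by
  unfold PositiveSchur at h
  push Not at h
  obtain ⟨x, hx, hxw, hxn⟩ := h
  obtain ⟨δ, hδ, φ, hφ, hxδ⟩ := exists_subseq_le_norm hxn
  by_cases hinf : ∀ i, NormNull fun n => x (φ i) ⊓ x (φ n)
  · obtain ⟨ψ, v, hψ, hv, hvx, hvδ, hdisj⟩ :=
      exists_disjoint_of_tendsto_inf (fun n => hx (φ n)) hδ hxδ hinf
    exact ⟨v, δ / 2, half_pos hδ, hv,
      (hxw.comp_strictMono (hφ.comp hψ)).of_nonneg_of_le hv hvx, hvδ, hdisj⟩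
  · push Not at hinf
    obtain ⟨i, hi⟩ := hinf
    obtain ⟨δ', hδ', ψ, hψ, hψδ⟩ := exists_subseq_le_norm hi
    -- These infima lie in the order interval below `x (φ i)` and are weakly null by domination.
    have h0 : ∀ n, 0 ≤ x (φ i) ⊓ x (φ (ψ n)) := fun n => le_inf (hx _) (hx _)
    obtain ⟨v, ε, hε, hv, hvu, hvε, hdisj⟩ := exists_disjoint_of_weaklyNull_of_le hδ' h0
      (fun n => inf_le_left) hψδ
      ((hxw.comp_strictMono (hφ.comp hψ)).of_nonneg_of_le h0 fun n => inf_le_right)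
    exact ⟨v, ε, hε, hv, weaklyNull_of_disjoint_of_le (hx _) hv hvu hdisj, hvε, hdisj⟩

/-! ### Tensor products of disjoint weakly null sequences -/

/-- Continuous multilinear forms tend to zero along disjoint weakly null sequences in spaces with
the weak Dunford-Pettis property. -/
theorem tendsto_continuousMultilinearMap_of_weaklyNull (n : ℕ) :
    ∀ (E : Fin (n + 1) → Type u) [∀ i, NormedAddCommGroup (E i)] [∀ i, NormedSpace ℝ (E i)]
      [∀ i, Lattice (E i)] (_ : ∀ i, WeakDunfordPettis (E i)) (x : ∀ i, ℕ → E i)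
      (_ : ∀ i, WeaklyNull (x i)) (_ : ∀ i j k, j ≠ k → |x i j| ⊓ |x i k| = 0)
      (Φ : ContinuousMultilinearMap ℝ E ℝ), Tendsto (fun j => Φ fun i => x i j) atTop (𝓝 0) := by
  have hcurry : ∀ (n : ℕ) (E : Fin (n + 1) → Type u) [∀ i, NormedAddCommGroup (E i)]
      [∀ i, NormedSpace ℝ (E i)] (Φ : ContinuousMultilinearMap ℝ E ℝ) (y : ∀ i, E i),
      Φ y = Φ.curryRight (fun i => y i.castSucc) (y (Fin.last n)) := by
    intro n E _ _ Φ y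
    rw [ContinuousMultilinearMap.curryRight_apply]
    congr 1
    exact (Fin.snoc_init_self y).symm
  induction n with
  | zero =>
    intro E _ _ _ _ x hx _ Φ
    have h : ∀ j, (Φ fun i => x i j) = Φ.curryRight 0 (x 0 j) := by
      intro j
      rw [hcurry 0 E Φ]
      congr 2
      exact Subsingleton.elim _ _
    simp only [h]
    exact hx 0 _
  | succ n ih =>
    intro E _ _ _ hDP x hx hdisj Φ
    simp only [hcurry (n + 1) E Φ]
    -- It remains to see that the functionals with all but the last variable frozen are weakly null:
    -- composing with `ψ` in the bidual leaves a form in one variable fewer.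
    refine (hDP (Fin.last _)).tendsto_apply (hx _) (hdisj _) fun ψ => ?_
    exact ih (fun i => E i.castSucc) (fun i => hDP _) (fun i => x i.castSucc) (fun i => hx _)
      (fun i => hdisj _) (ψ.compContinuousMultilinearMap Φ.curryRight)

/-! ### Passage to the completed tensor product -/

section FremlinTensor

variable {ι : Type} [Fintype ι] [Nonempty ι] {E : ι → Type u} [∀ i, NormedAddCommGroup (E i)]
  [∀ i, NormedSpace ℝ (E i)] [∀ i, Lattice (E i)] [∀ i, IsOrderedAddMonoid (E i)]
  [∀ i, IsOrderedModule ℝ (E i)] [∀ i, HasSolidNorm (E i)]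

/-- The continuous multilinear form induced by a functional on the Fremlin tensor product. -/
noncomputable def fremlinForm (f : StrongDual ℝ (FremlinTensor E)) :
    ContinuousMultilinearMap ℝ E ℝ :=
  MultilinearMap.mkContinuous
    ((f.toLinearMap.comp
      (UniformSpace.Completion.toComplL (𝕜 := ℝ) (E := RieszTensor E)).toLinearMap).compMultilinearMap
      RieszTensor.tmul) ‖f‖ (fun x => by
    refine (f.le_opNorm _).trans (mul_le_mul_of_nonneg_left ?_ (norm_nonneg f))
    exact (UniformSpace.Completion.norm_coe _).trans_le (norm_tmul_le x))

theorem prod_norm_le_norm_fremlinTmul [∀ i, CompleteSpace (E i)] {x : ∀ i, E i}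
    (hx : ∀ i, 0 ≤ x i) : ∏ i, ‖x i‖ ≤ ‖fremlinTmul x‖ :=
  (prod_norm_le_norm_tmul hx).trans_eq (UniformSpace.Completion.norm_coe _).symm

end FremlinTensor

theorem mainTheorem11 {n : ℕ} [NeZero n] (E : Fin n → Type u)
    [∀ i, NormedAddCommGroup (E i)] [∀ i, NormedSpace ℝ (E i)] [∀ i, CompleteSpace (E i)]
    [∀ i, Lattice (E i)] [∀ i, IsOrderedAddMonoid (E i)] [∀ i, IsOrderedModule ℝ (E i)]
    [∀ i, HasSolidNorm (E i)]
    (hDP : ∀ i, WeakDunfordPettis (E i)) (hPS : ∀ i, ¬ PositiveSchur (E i)) :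
    ∃ x : ∀ i, ℕ → E i, (∀ i j, 0 ≤ x i j) ∧
      WeaklyNull (fun j => fremlinTmul (fun i => x i j)) ∧
      ¬ NormNull (fun j => fremlinTmul (fun i => x i j)) := by
  choose x δ hδ hx hxw hxδ hdisj using fun i =>
    exists_disjoint_weaklyNull_of_not_positiveSchur (hPS i)
  refine ⟨x, hx, fun f => ?_, fun h => ?_⟩
  · have key : Tendsto (fun j => fremlinForm f fun i => x i j) atTop (𝓝 0) := by
      generalize fremlinForm f = Φ
      obtain ⟨m, rfl⟩ := Nat.exists_eq_succ_of_ne_zero (NeZero.ne n)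
      refine tendsto_continuousMultilinearMap_of_weaklyNull m E hDP x hxw (fun i j k hjk => ?_) Φ
      rw [abs_of_nonneg (hx i j), abs_of_nonneg (hx i k)]
      exact hdisj i j k hjk
    exact key
  · have hle : ∀ j, ∏ i, δ i ≤ ‖fremlinTmul fun i => x i j‖ := fun j =>
      (Finset.prod_le_prod (fun i _ => (hδ i).le) fun i _ => hxδ i j).trans
        (prod_norm_le_norm_fremlinTmul fun i => hx i j)
    exact absurd (ge_of_tendsto' h hle) (Finset.prod_pos fun i _ => hδ i).not_ge
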